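/- Let $n\ge 1$ and let $B_n$ be the $n$-string braid group with Artin generators $\sigma_1,\dots,\sigma_{n-1}$. For $n\ge t>s\ge 1$ let $$a_{ts}=(\sigma_{t-1}\sigma_{t-2}\cdots\sigma_{s+1})\,\sigma_s\,(\sigma_{s+1}^{-1}\cdots\sigma_{t-2}^{-1}\sigma_{t-1}^{-1})$$ be the band generators, let $B_n^+\subset B_n$ be the monoid they generate (its elements are the positive braids), and let $\delta=a_{n(n-1)}a_{(n-1)(n-2)}\cdots a_{21}$. Write $V\le W$ if $W=P_1VP_2$ for some $P_1,P_2\in B_n^+$; in particular $P\ge e$ means that $P$ is positive. A canonical factor is a braid $A$ with $e\le A\le\delta$. A descending cycle is a cycle $\pi=(t_m,t_{m-1},\dots,t_1)$ on $\{1,\dots,n\}$ with $m\ge 2$ and $t_m>t_{m-1}>\cdots>t_1$, and $\delta_\pi=a_{t_mt_{m-1}}a_{t_{m-1}t_{m-2}}\cdots a_{t_2t_1}$. Descending cycles $(t_j,\dots,t_1)$ and $(s_i,\dots,s_1)$ are parallel if $(t_a-s_c)(t_a-s_d)(t_b-s_c)(t_b-s_d)>0$ for all $1\le a<b\le j$ and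 $1\le c<d\le i$. The starting set $S(P)$ (respectively the finishing set $F(P)$) of a braid $P$ is the set of band generators $a$ such that $P=aP'$ (respectively $P=P'a$) for some $P'\ge e$. Then: (I) If $\pi=(t_m,\dots,t_1)$ is a descending cycle, then $S(\delta_\pi)=F(\delta_\pi)=\{a_{t_jt_i} : m\ge j>i\ge 1\}$. (II) If $\pi_1,\dots,\pi_k$ are pairwise parallel descending cycles, then $S(\delta_{\pi_1}\cdots\delta_{\pi_k})=S(\delta_{\pi_1})\cup\cdots\cup S(\delta_{\pi_k})$. (III) If $A$ is a canonical factor, then $S(A)=F(A)$. (IV) If $A$ and $B$ are canonical factors and $S(A)=S(B)$, then $A=B$. (V) For every positive $P$ there is a canonical factor $A$ with $S(P)=S(A)$. (VI) If $P$ is positive and $A$ is a canonical factor with $S(A)\subseteq S(P)$, then $P=AP'$ for some $P'\ge e$. (VII) For every $P\ge e$ there is a unique canonical factor $A$ such that $P=AP'$ for some $P'\ge e$ and $S(P)=S(A)$. -/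

import Mathlib

namespace BandBraid

/-- The relators of Artin's presentation on the generators `σ_0, …, σ_{n-2}`. -/
def artinRels (n : ℕ) : Set (FreeGroup (Fin (n - 1))) :=
  {r | ∃ t s : Fin (n - 1), 1 < |(t : ℤ) - (s : ℤ)| ∧
      r = (FreeGroup.of t * FreeGroup.of s) * (FreeGroup.of s * FreeGroup.of t)⁻¹} ∪
  {r | ∃ t s : Fin (n - 1), |(t : ℤ) - (s : ℤ)| = 1 ∧
      r = (FreeGroup.of t * FreeGroup.of s * FreeGroup.of t) *
        (FreeGroup.of s * FreeGroup.of t * FreeGroup.of s)⁻¹}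

/-- The `n`-string braid group `B_n`. Strands are numbered `0, …, n - 1` (elements of `Fin n`)
instead of `1, …, n`. -/
abbrev BraidGroup (n : ℕ) : Type := PresentedGroup (artinRels n)

/-- The Artin generator `σ_k`, which interchanges the strands `k` and `k + 1`. It is only used
for `k + 1 < n`; outside this range the value is `1`. -/
def sigma (n k : ℕ) : BraidGroup n :=
  if h : k < n - 1 then PresentedGroup.of ⟨k, h⟩ else 1

/-- The descending product `σ_{t-1} σ_{t-2} ⋯ σ_{s+1}` (empty if `t = s + 1`). -/
def sigmaDown (n t s : ℕ) : BraidGroup n :=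
  ((List.Ico (s + 1) t).reverse.map (sigma n)).prod

/-- For `s < t`, the band generator
`a_{ts} = (σ_{t-1} ⋯ σ_{s+1}) σ_s (σ_{s+1}⁻¹ ⋯ σ_{t-1}⁻¹)`. -/
def band {n : ℕ} (t s : Fin n) : BraidGroup n :=
  sigmaDown n t s * sigma n s * (sigmaDown n t s)⁻¹

/-- The set of all band generators `a_{ts}` with `t > s`. -/
def bandGenerators (n : ℕ) : Set (BraidGroup n) :=
  {a | ∃ t s : Fin n, s < t ∧ a = band t s}

/-- The monoid `B_n⁺` of positive braids inside `B_n`: the braids represented by positive words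
in the band generators. -/
def positiveBraids (n : ℕ) : Submonoid (BraidGroup n) :=
  Submonoid.closure (bandGenerators n)

/-- `V ≤ W`: `W = P₁ V P₂` for some positive braids `P₁`, `P₂`. -/
def BraidLE {n : ℕ} (V W : BraidGroup n) : Prop :=
  ∃ P₁ ∈ positiveBraids n, ∃ P₂ ∈ positiveBraids n, W = P₁ * V * P₂

/-- `a_{t_m t_{m-1}} a_{t_{m-1} t_{m-2}} ⋯ a_{t_2 t_1}` for a subscript array
`(t_m, t_{m-1}, …, t_1)`. -/
def chain {n : ℕ} : List (Fin n) → BraidGroup n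
  | t :: s :: l => band t s * chain (s :: l)
  | _ => 1

/-- The fundamental braid `δ = a_{n(n-1)} a_{(n-1)(n-2)} ⋯ a_{21}`. -/
def delta (n : ℕ) : BraidGroup n := chain (List.finRange n).reverse

/-- A descending cycle `(t_m, t_{m-1}, …, t_1)` with `t_m > t_{m-1} > ⋯ > t_1` and `m ≥ 2`,
given by its subscript array (which determines and is determined by the permutation). -/
structure DescendingCycle (n : ℕ) where
  /-- the subscript array, largest entry first -/
  subscripts : List (Fin n)
  two_le_length : 2 ≤ subscripts.length
  descending : subscripts.Pairwise (fun t s => s < t)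

/-- The positive braid `δ_π = a_{t_m t_{m-1}} ⋯ a_{t_2 t_1}` of a descending cycle `π`. -/
def DescendingCycle.braid {n : ℕ} (π : DescendingCycle n) : BraidGroup n :=
  chain π.subscripts

/-- Two descending cycles are parallel if no two entries of one separate two entries of the
other. -/
def DescendingCycle.Parallel {n : ℕ} (π μ : DescendingCycle n) : Prop :=
  ∀ a ∈ π.subscripts, ∀ b ∈ π.subscripts, ∀ c ∈ μ.subscripts, ∀ d ∈ μ.subscripts,
    b < a → d < c →
      0 < ((a : ℤ) - (c : ℤ)) * ((a : ℤ) - (d : ℤ)) * ((b : ℤ) - (c : ℤ)) * ((b : ℤ) - (d : ℤ))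

/-- A canonical factor is a braid in `[0, 1]`, that is, `e ≤ A ≤ δ`. -/
def IsCanonicalFactor {n : ℕ} (A : BraidGroup n) : Prop :=
  BraidLE 1 A ∧ BraidLE A (delta n)

/-- The starting set `S(P)`. -/
def startingSet {n : ℕ} (P : BraidGroup n) : Set (BraidGroup n) :=
  {a | a ∈ bandGenerators n ∧ ∃ P' : BraidGroup n, BraidLE 1 P' ∧ P = a * P'}

/-- The finishing set `F(P)`. -/
def finishingSet {n : ℕ} (P : BraidGroup n) : Set (BraidGroup n) :=
  {a | a ∈ bandGenerators n ∧ ∃ P' : BraidGroup n, BraidLE 1 P' ∧ P = P' * a}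

end BandBraid

/-! Measure a permutation by the codimension of the space of functions constant on its cycles, and
order permutations by geodesic prefix. A transposition lies below `w` exactly when its two points
share a cycle of `w` (`swap_le_iff`). The interval below the n-cycle `descCycle n` is the
noncrossing partition lattice: it has meets, and its order is detected by transpositions
(`le_of_swap_le`).

Any interval with meets presents a cancellative monoid in which the simple left divisors of an
element are exactly those below one simple element, its head (`exists_eq_gen_mul_iff`). Because the
n-cycle has finite order, a power of the top element is central, and the monoid embeds in a group
(`exists_injective_hom_group`).

The relations between band generators show that all shortest words for a permutation below the
n-cycle give the same braid (`BandFact.unique`), so this dual monoid maps onto the positive braids.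
The Artin relations hold in the group just mentioned, which gives a homomorphism back and proves the
map injective (`toBraid_injective`).

Hence the canonical factors are the lifted simple elements (`isCanonicalFactor_iff`), and a starting
set lists the transpositions below a head (`startingSet_toBraid`). The claims become facts about
permutations: prefixes equal suffixes because length is conjugation invariant, a simple element is
determined by the transpositions below it, the head is the required canonical factor, and parallel
cycles multiply without merging. -/

namespace BandBraid

/-! ### Length functions and the prefix order. -/

/-- A length function on a group which is subadditive, conjugation invariant and vanishes only at
the identity. -/
structure LengthFunction (Γ : Type*) [Group Γ] where
  /-- the length of an element -/
  len : Γ → ℕ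
  len_eq_zero : ∀ g, len g = 0 ↔ g = 1
  len_mul_le : ∀ g h, len (g * h) ≤ len g + len h
  len_conj : ∀ g h, len (h * g * h⁻¹) = len g

namespace LengthFunction

variable {Γ : Type*} [Group Γ] (L : LengthFunction Γ)

/-- The prefix order: `u` is an initial segment of a geodesic from `1` to `w`. -/
def Le (u w : Γ) : Prop := L.len u + L.len (u⁻¹ * w) = L.len w

variable {L}

@[simp] lemma len_one : L.len 1 = 0 := (L.len_eq_zero 1).2 rfl

lemma le_refl (u : Γ) : L.Le u u := by simp [Le]

lemma one_le (u : Γ) : L.Le 1 u := by simp [Le]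

lemma le_mul_iff {u v : Γ} : L.Le u (u * v) ↔ L.len u + L.len v = L.len (u * v) := by
  simp [Le]

lemma len_le_of_le {u w : Γ} (h : L.Le u w) : L.len u ≤ L.len w := by
  unfold Le at h; omega

lemma le_trans {u v w : Γ} (h₁ : L.Le u v) (h₂ : L.Le v w) : L.Le u w := by
  unfold Le at *
  have h3 := L.len_mul_le u (u⁻¹ * w)
  have h4 := L.len_mul_le (u⁻¹ * v) (v⁻¹ * w)
  rw [show u * (u⁻¹ * w) = w by group] at h3
  rw [show u⁻¹ * v * (v⁻¹ * w) = u⁻¹ * w by group] at h4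
  omega

lemma eq_of_le_of_len_le {u v : Γ} (h : L.Le u v) (hl : L.len v ≤ L.len u) : u = v := by
  unfold Le at h
  have : L.len (u⁻¹ * v) = 0 := by omega
  rw [L.len_eq_zero, inv_mul_eq_one] at this
  exact this

lemma le_antisymm {u v : Γ} (h₁ : L.Le u v) (h₂ : L.Le v u) : u = v :=
  eq_of_le_of_len_le h₁ (len_le_of_le h₂)

lemma le_one_iff {u : Γ} : L.Le u 1 ↔ u = 1 := by
  refine ⟨fun h => le_antisymm h (one_le u), ?_⟩
  rintro rfl
  exact LengthFunction.le_refl 1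

lemma len_mul_comm (u v : Γ) : L.len (u * v) = L.len (v * u) := by
  rw [← L.len_conj (u * v) v]; congr 1; group

/-- Being a prefix is the same as being a suffix. -/
lemma le_mul_left_iff {u v : Γ} : L.Le v (u * v) ↔ L.len u + L.len v = L.len (u * v) := by
  unfold Le
  rw [L.len_mul_comm v⁻¹, mul_inv_cancel_right, add_comm]

/-- The complement `u⁻¹ w` of a prefix of `w` is again a prefix of `w`. -/
lemma inv_mul_le {u w : Γ} (h : L.Le u w) : L.Le (u⁻¹ * w) w := by
  have : w = u * (u⁻¹ * w) := by group
  conv_rhs => rw [this]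
  rw [le_mul_left_iff, mul_inv_cancel_left]
  exact h

lemma mul_le_mul_iff {v a b : Γ} (ha : L.Le v (v * a)) (hb : L.Le v (v * b)) :
    L.Le (v * a) (v * b) ↔ L.Le a b := by
  rw [le_mul_iff] at ha hb
  unfold Le
  rw [show (v * a)⁻¹ * (v * b) = a⁻¹ * b by group]
  omega

lemma inv_mul_le_inv_mul_iff {v a b : Γ} (ha : L.Le v a) (hb : L.Le v b) :
    L.Le (v⁻¹ * a) (v⁻¹ * b) ↔ L.Le a b := by
  have := mul_le_mul_iff (L := L) (v := v) (a := v⁻¹ * a) (b := v⁻¹ * b) (by simpa) (by simpa)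
  simpa using this.symm

/-- `v * a` is a geodesic product below `c` as soon as `a` is below `v⁻¹ c`. -/
lemma mul_le_of_le_inv_mul {v a c : Γ} (hv : L.Le v c) (ha : L.Le a (v⁻¹ * c)) :
    L.Le v (v * a) ∧ L.Le (v * a) c := by
  rw [le_mul_iff]
  unfold Le at *
  have h1 := L.len_mul_le v a
  have h2 := L.len_mul_le (v * a) ((v * a)⁻¹ * c)
  rw [mul_inv_cancel_left] at h2
  rw [← mul_assoc, ← mul_inv_rev] at ha
  omega

lemma le_inv_mul_of_mul_le {v a c : Γ} (hv : L.Le v (v * a)) (ha : L.Le (v * a) c) :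
    L.Le a (v⁻¹ * c) := by
  rw [← inv_mul_le_inv_mul_iff hv (le_trans hv ha)] at ha
  simpa using ha

lemma le_of_geodesic_right {u v : Γ} (h : L.Le u (u * v)) : L.Le v (u * v) := by
  rw [le_mul_left_iff, ← le_mul_iff]; exact h

/-! ### The monoid of an interval with meets: heads and normal forms. -/

variable (L)

/-- The interval `[1, c]` of a length function is a meet semilattice. -/
class IsMeetInterval (c : Γ) : Prop where
  exists_inf : ∀ u v, L.Le u c → L.Le v c →
    ∃ m, L.Le m u ∧ L.Le m v ∧ ∀ b, L.Le b u → L.Le b v → L.Le b m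

variable (c : Γ)

/-- The elements of the interval `[1, c]`. -/
abbrev Simple : Type _ := {u : Γ // L.Le u c}

variable {L c}

/-- The complement `u⁻¹ c` of a simple element. -/
def Simple.compl (u : L.Simple c) : L.Simple c := ⟨u.1⁻¹ * c, inv_mul_le u.2⟩

/-- The product of `u` with an element below its complement. -/
def Simple.mul (u v : L.Simple c) (h : L.Le v.1 (u.1⁻¹ * c)) : L.Simple c :=
  ⟨u.1 * v.1, (mul_le_of_le_inv_mul u.2 h).2⟩

/-- The quotient `u⁻¹ v` of two simple elements. -/
def Simple.quot (u v : L.Simple c) (h : L.Le u.1 v.1) : L.Simple c :=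
  ⟨u.1⁻¹ * v.1, le_trans (inv_mul_le h) v.2⟩

section Meet

variable [hM : L.IsMeetInterval c]

/-- The meet of two simple elements. -/
noncomputable def Simple.meet (u v : L.Simple c) : L.Simple c :=
  ⟨(hM.exists_inf u.1 v.1 u.2 v.2).choose,
    le_trans (hM.exists_inf u.1 v.1 u.2 v.2).choose_spec.1 u.2⟩

lemma Simple.meet_le_left (u v : L.Simple c) : L.Le (u.meet v).1 u.1 :=
  (hM.exists_inf u.1 v.1 u.2 v.2).choose_spec.1

lemma Simple.meet_le_right (u v : L.Simple c) : L.Le (u.meet v).1 v.1 :=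
  (hM.exists_inf u.1 v.1 u.2 v.2).choose_spec.2.1

lemma Simple.le_meet {u v : L.Simple c} {b : Γ} (h₁ : L.Le b u.1) (h₂ : L.Le b v.1) :
    L.Le b (u.meet v).1 :=
  (hM.exists_inf u.1 v.1 u.2 v.2).choose_spec.2.2 b h₁ h₂

/-- The meet of the complement of `u` with `s`: the largest part of `s` which `u` absorbs. -/
noncomputable def Simple.part (u s : L.Simple c) : L.Simple c := u.compl.meet s

lemma Simple.part_le_compl (u s : L.Simple c) : L.Le (u.part s).1 (u.1⁻¹ * c) :=
  Simple.meet_le_left _ _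

lemma Simple.part_le (u s : L.Simple c) : L.Le (u.part s).1 s.1 :=
  Simple.meet_le_right _ _

/-- The head of `u s`: the largest simple prefix of the formal product. -/
noncomputable def Simple.head (u s : L.Simple c) : L.Simple c :=
  u.mul (u.part s) (u.part_le_compl s)

/-- The tail of `u s`. -/
noncomputable def Simple.tail (u s : L.Simple c) : L.Simple c :=
  (u.part s).quot s (u.part_le s)

/-- This is the associativity behind `normalize`: absorbing `s` into `v` and then the result into
`u` takes `v` together with whatever `u v` would absorb from `s` directly. -/
lemma Simple.part_head {u v w : L.Simple c} (h : L.Le u.1 w.1) (hw : u.1 * v.1 = w.1)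
    (s : L.Simple c) : (u.part (v.head s)).1 = v.1 * (w.part s).1 := by
  have hv : L.Le v.1 (u.1⁻¹ * c) := by
    have := le_inv_mul_of_mul_le (L := L) (v := u.1) (a := v.1) (c := c)
    rw [hw] at this
    exact this h w.2
  have hwc : w.1⁻¹ * c = v.1⁻¹ * (u.1⁻¹ * c) := by rw [← hw]; group
  have hwv : L.Le (w.1⁻¹ * c) (v.1⁻¹ * c) := by
    rw [hwc]
    exact (inv_mul_le_inv_mul_iff hv v.2).2 (inv_mul_le u.2)
  have hwp := w.part_le_compl s
  have hvh : L.Le v.1 (v.head s).1 := (mul_le_of_le_inv_mul v.2 (v.part_le_compl s)).1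
  have hvw : L.Le v.1 (v.1 * (w.part s).1) :=
    (mul_le_of_le_inv_mul v.2 (le_trans hwp hwv)).1
  refine le_antisymm (L := L) ?_ ?_
  · have h1 : L.Le (v.1 * (w.part s).1) (u.part (v.head s)).1 := by
      refine Simple.le_meet ?_ ?_
      · rw [hwc] at hwp
        exact (mul_le_of_le_inv_mul hv hwp).2
      · refine (mul_le_mul_iff hvw hvh).2 ?_
        exact Simple.le_meet (le_trans hwp hwv) (w.part_le s)
    have h2 : L.Le v.1 (u.part (v.head s)).1 := le_trans hvw h1
    have h3 : L.Le (v.1⁻¹ * (u.part (v.head s)).1) (w.part s).1 := by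
      refine Simple.le_meet ?_ ?_
      · change L.Le _ (w.1⁻¹ * c)
        rw [hwc]
        exact (inv_mul_le_inv_mul_iff h2 hv).2 (u.part_le_compl _)
      · have h4 := (inv_mul_le_inv_mul_iff h2 hvh).2 (u.part_le (v.head s))
        have h5 : v.1⁻¹ * (v.head s).1 = (v.part s).1 := by simp [Simple.head, Simple.mul]
        rw [h5] at h4
        exact le_trans h4 (v.part_le s)
    rw [← mul_le_mul_iff (v := v.1) (by simpa using h2) hvw] at h3
    simpa using h3
  · refine Simple.le_meet ?_ ?_
    · rw [hwc] at hwp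
      exact (mul_le_of_le_inv_mul hv hwp).2
    · refine (mul_le_mul_iff hvw hvh).2 ?_
      exact Simple.le_meet (le_trans hwp hwv) (w.part_le s)

end Meet

variable (L c)

/-- The defining relations of the monoid attached to the interval `[1, c]`. -/
inductive GermRel : FreeMonoid (L.Simple c) → FreeMonoid (L.Simple c) → Prop
  | one (u : L.Simple c) (h : u.1 = 1) : GermRel (FreeMonoid.of u) 1
  | mul (u v w : L.Simple c) (h : u.1 * v.1 = w.1) (hl : L.Le u.1 w.1) :
      GermRel (FreeMonoid.of u * FreeMonoid.of v) (FreeMonoid.of w)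

/-- The interval monoid of `[1, c]`. -/
abbrev IntervalMonoid : Type _ := PresentedMonoid (GermRel L c)

variable {L c}

/-- The generator of the interval monoid given by a simple element. -/
def gen (u : L.Simple c) : L.IntervalMonoid c := PresentedMonoid.of _ u

lemma gen_eq_one {u : L.Simple c} (h : u.1 = 1) : gen u = 1 :=
  PresentedMonoid.mk_eq_mk_of_rel (GermRel.one u h)

lemma gen_mul_gen {u v w : L.Simple c} (h : u.1 * v.1 = w.1) (hl : L.Le u.1 w.1) :
    gen u * gen v = gen w :=
  PresentedMonoid.mk_eq_mk_of_rel (GermRel.mul u v w h hl)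

lemma gen_mul_gen_quot {u v : L.Simple c} (h : L.Le u.1 v.1) :
    gen u * gen (u.quot v h) = gen v :=
  gen_mul_gen (by simp [Simple.quot]) h

@[elab_as_elim]
lemma IntervalMonoid.induction {p : L.IntervalMonoid c → Prop} (h1 : p 1)
    (hmul : ∀ u P, p P → p (gen u * P)) (P : L.IntervalMonoid c) : p P := by
  obtain ⟨a, rfl⟩ := PresentedMonoid.surjective_mk P
  induction a using FreeMonoid.inductionOn' with
  | one => exact h1
  | of_mul u a ih => exact hmul u _ ih

/-- The extension to the interval monoid of a map on simple elements. -/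
def liftGerm {N : Type*} [Monoid N] (f : L.Simple c → N) (h1 : ∀ u, u.1 = 1 → f u = 1)
    (hmul : ∀ u v w : L.Simple c, u.1 * v.1 = w.1 → L.Le u.1 w.1 → f u * f v = f w) :
    L.IntervalMonoid c →* N :=
  PresentedMonoid.lift f (by
    rintro a b (⟨u, h⟩ | ⟨u, v, w, h, hl⟩)
    · simpa using h1 u h
    · simpa using hmul u v w h hl)

section Action

variable [hM : L.IsMeetInterval c]

/-- The action of a simple element on pairs (head, remainder). -/
noncomputable def step (u : L.Simple c) :
    Function.End (L.Simple c × L.IntervalMonoid c) :=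
  fun p => (u.head p.1, gen (u.tail p.1) * p.2)

/-- The action of the interval monoid on pairs (head, remainder). -/
noncomputable def normalize :
    L.IntervalMonoid c →* Function.End (L.Simple c × L.IntervalMonoid c) :=
  liftGerm step
    (by
      intro u hu
      funext p
      have hp : (u.part p.1).1 = p.1.1 := by
        refine le_antisymm (L := L) (u.part_le _) (Simple.le_meet ?_ (le_refl _))
        change L.Le _ (u.1⁻¹ * c)
        simpa [hu] using p.1.2
      refine Prod.ext (Subtype.ext ?_) ?_
      · change u.1 * (u.part p.1).1 = p.1.1
        rw [hu, one_mul, hp]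
      · change gen (u.tail p.1) * p.2 = p.2
        rw [gen_eq_one, one_mul]
        change (u.part p.1).1⁻¹ * p.1.1 = 1
        rw [hp, inv_mul_cancel])
    (by
      intro u v w h hl
      funext p
      have hp := Simple.part_head hl h p.1
      refine Prod.ext (Subtype.ext ?_) ?_
      · change u.1 * (u.part (v.head p.1)).1 = w.1 * (w.part p.1).1
        rw [hp, ← h, mul_assoc]
      · change gen (u.tail (v.head p.1)) * (gen (v.tail p.1) * p.2) = gen (w.tail p.1) * p.2
        rw [← mul_assoc]
        congr 1
        -- The two leftovers multiply to the single leftover of `w`; that product is geodesic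
        -- because `w` absorbs no more of the head than `v` does.
        have hq : (u.tail (v.head p.1)).1 = (w.part p.1).1⁻¹ * (v.part p.1).1 := by
          change (u.part (v.head p.1)).1⁻¹ * (v.1 * (v.part p.1).1) = _
          rw [hp]; group
        have hwv : L.Le (w.part p.1).1 (v.part p.1).1 := by
          refine Simple.le_meet ?_ (w.part_le _)
          refine le_trans (w.part_le_compl _) ?_
          have hv : L.Le v.1 (u.1⁻¹ * c) := by
            have := le_inv_mul_of_mul_le (L := L) (v := u.1) (a := v.1) (c := c)
            rw [h] at this
            exact this hl w.2
          have hwc : w.1⁻¹ * c = v.1⁻¹ * (u.1⁻¹ * c) := by rw [← h]; group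
          rw [hwc]
          exact (inv_mul_le_inv_mul_iff hv v.2).2 (inv_mul_le u.2)
        refine gen_mul_gen ?_ ?_
        · rw [hq]
          change _ * ((v.part p.1).1⁻¹ * p.1.1) = (w.part p.1).1⁻¹ * p.1.1
          group
        · rw [hq]
          exact (inv_mul_le_inv_mul_iff hwv (w.part_le _)).2 (v.part_le _))

variable (L c) in
/-- The identity as a simple element. -/
def oneSimple : L.Simple c := ⟨1, one_le c⟩

/-- The head of an element of the interval monoid. -/
noncomputable def IntervalMonoid.head (P : L.IntervalMonoid c) : L.Simple c :=
  (normalize P (oneSimple L c, 1)).1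

/-- The remainder of an element of the interval monoid after division by its head. -/
noncomputable def IntervalMonoid.rest (P : L.IntervalMonoid c) : L.IntervalMonoid c :=
  (normalize P (oneSimple L c, 1)).2

lemma normalize_gen_mul (u : L.Simple c) (P : L.IntervalMonoid c) (p) :
    normalize (gen u * P) p = step u (normalize P p) := by
  rw [map_mul]; rfl

open IntervalMonoid in
lemma head_gen_mul (u : L.Simple c) (P : L.IntervalMonoid c) :
    head (gen u * P) = u.head P.head := by
  simp only [head, normalize_gen_mul]; rfl

open IntervalMonoid in
lemma rest_gen_mul (u : L.Simple c) (P : L.IntervalMonoid c) :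
    rest (gen u * P) = gen (u.tail P.head) * P.rest := by
  simp only [rest, normalize_gen_mul]; rfl

lemma gen_head_mul_gen_tail (u s : L.Simple c) :
    gen (u.head s) * gen (u.tail s) = gen u * gen s := by
  have h1 : gen (u.head s) = gen u * gen (u.part s) :=
    (gen_mul_gen rfl (mul_le_of_le_inv_mul u.2 (u.part_le_compl s)).1).symm
  rw [h1, mul_assoc]
  congr 1
  exact gen_mul_gen_quot (u.part_le s)

lemma gen_head_mul_rest (P : L.IntervalMonoid c) : gen P.head * P.rest = P := by
  induction P using IntervalMonoid.induction with
  | h1 =>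
    have h : (IntervalMonoid.head (1 : L.IntervalMonoid c)).1 = 1 := by
      simp only [IntervalMonoid.head, map_one]; rfl
    rw [gen_eq_one h, one_mul]
    simp only [IntervalMonoid.rest, map_one]; rfl
  | hmul u P ih =>
    rw [head_gen_mul, rest_gen_mul, ← mul_assoc, gen_head_mul_gen_tail, mul_assoc, ih]

/-- The simple left divisors of `P` are the simple elements below its head. -/
lemma exists_eq_gen_mul_iff {u : L.Simple c} {P : L.IntervalMonoid c} :
    (∃ Q, P = gen u * Q) ↔ L.Le u.1 P.head.1 := by
  constructor
  · rintro ⟨Q, rfl⟩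
    rw [head_gen_mul]
    exact (mul_le_of_le_inv_mul u.2 (u.part_le_compl _)).1
  · intro h
    refine ⟨gen (u.quot _ h) * P.rest, ?_⟩
    rw [← mul_assoc, gen_mul_gen_quot, gen_head_mul_rest]

lemma head_gen (u : L.Simple c) : (gen u).head = u := by
  have h := head_gen_mul u (1 : L.IntervalMonoid c)
  rw [mul_one] at h
  rw [h]
  have h1 : (IntervalMonoid.head (1 : L.IntervalMonoid c)).1 = 1 := by
    simp only [IntervalMonoid.head, map_one]; rfl
  refine Subtype.ext ?_
  change u.1 * (u.part _).1 = u.1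
  have h2 := u.part_le (IntervalMonoid.head 1)
  rw [h1, le_one_iff] at h2
  rw [h2, mul_one]

lemma gen_injective : Function.Injective (gen : L.Simple c → L.IntervalMonoid c) :=
  Function.LeftInverse.injective head_gen

/-- The head of the product reveals the part absorbed by `u`, and its rest reveals everything else;
together they rebuild `P`. -/
lemma gen_mul_left_cancel {u : L.Simple c} {P Q : L.IntervalMonoid c}
    (h : gen u * P = gen u * Q) : P = Q := by
  have hh := congrArg IntervalMonoid.head h
  have hr := congrArg IntervalMonoid.rest h
  rw [head_gen_mul, head_gen_mul] at hh
  rw [rest_gen_mul, rest_gen_mul] at hr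
  have hp : u.part P.head = u.part Q.head := by
    have := congrArg Subtype.val hh
    exact Subtype.ext (mul_left_cancel this)
  rw [← gen_head_mul_rest P, ← gen_head_mul_rest Q, ← gen_mul_gen_quot (u.part_le P.head),
    ← gen_mul_gen_quot (u.part_le Q.head), mul_assoc, mul_assoc]
  rw [show (u.part P.head).quot P.head (u.part_le _) = u.tail P.head from rfl,
    show (u.part Q.head).quot Q.head (u.part_le _) = u.tail Q.head from rfl, hr, hp]

end Action

end LengthFunction

end BandBraid
namespace BandBraid

/-! ### Embedding the interval monoid into a group of fractions. -/

namespace LengthFunction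

universe u

variable {Γ : Type u} [Group Γ] {L : LengthFunction Γ} {c : Γ}

/-- The evaluation of the interval monoid in the ambient group. -/
def eval : L.IntervalMonoid c →* Γ :=
  liftGerm (fun u => u.1) (fun _ h => h) (fun _ _ _ h _ => h)

/-- The word length on the interval monoid. -/
def length : L.IntervalMonoid c →* Multiplicative ℕ :=
  liftGerm (fun u => Multiplicative.ofAdd (L.len u.1))
    (fun u h => by rw [h, len_one]; rfl)
    (fun u v w h hl => by
      rw [← h, le_mul_iff] at hl
      rw [← ofAdd_add, hl, h])

@[simp] lemma eval_gen (u : L.Simple c) : eval (gen u) = u.1 := rfl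

@[simp] lemma length_gen (u : L.Simple c) :
    length (gen u) = Multiplicative.ofAdd (L.len u.1) := rfl

lemma len_eval_le (P : L.IntervalMonoid c) : L.len (eval P) ≤ (length P).toAdd := by
  induction P using IntervalMonoid.induction with
  | h1 => simp
  | hmul u P ih =>
    have := L.len_mul_le u.1 (eval P)
    simp only [map_mul, eval_gen, length_gen, toAdd_mul, toAdd_ofAdd]
    omega

/-- If evaluation loses no length, every multiplication along a word for `P` is geodesic, so the
defining relations collapse the word to one generator. -/
lemma eq_gen_of_length_le {P : L.IntervalMonoid c} (hl : (length P).toAdd ≤ L.len (eval P))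
    (hc : L.Le (eval P) c) : P = gen ⟨eval P, hc⟩ := by
  induction P using IntervalMonoid.induction with
  | h1 => exact (gen_eq_one (by simp)).symm
  | hmul u P ih =>
    have h1 := L.len_mul_le u.1 (eval P)
    have h2 := len_eval_le P
    simp only [map_mul, eval_gen, length_gen, toAdd_mul, toAdd_ofAdd] at hl hc
    have h3 : L.Le u.1 (u.1 * eval P) := by rw [le_mul_iff]; omega
    have h4 : L.Le (eval P) c := le_trans (le_of_geodesic_right h3) hc
    exact (congrArg (gen u * ·) (ih (by omega) h4)).trans
      (gen_mul_gen (by simp) (by simpa using h3))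

/-- Factors of simple elements are simple, and their product is geodesic. -/
lemma exists_gen_of_mul_eq_gen {P Q : L.IntervalMonoid c} {w : L.Simple c}
    (h : P * Q = gen w) : ∃ u v : L.Simple c, P = gen u ∧ Q = gen v ∧ u.1 * v.1 = w.1 ∧
      L.Le u.1 w.1 := by
  have he : eval P * eval Q = w.1 := by rw [← map_mul, h, eval_gen]
  have hl : (length P).toAdd + (length Q).toAdd = L.len w.1 := by
    rw [← toAdd_mul, ← map_mul, h, length_gen, toAdd_ofAdd]
  have h1 := len_eval_le P
  have h2 := len_eval_le Q
  have h3 := L.len_mul_le (eval P) (eval Q)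
  rw [he] at h3
  have hg : L.Le (eval P) w.1 := by
    rw [← he, le_mul_iff, he]; omega
  have hg' : L.Le (eval Q) w.1 := by
    rw [← he] at hg ⊢; exact le_of_geodesic_right hg
  exact ⟨_, _, eq_gen_of_length_le (by omega) (le_trans hg w.2),
    eq_gen_of_length_le (by omega) (le_trans hg' w.2), he, hg⟩

variable (L c) in
/-- The Garside element of the interval monoid. -/
def top : L.IntervalMonoid c := gen ⟨c, le_refl c⟩

lemma gen_mul_gen_compl (u : L.Simple c) : gen u * gen u.compl = top L c :=
  gen_mul_gen (by simp [Simple.compl]) u.2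

/-- Taking the complement twice is conjugation by `c`, so passing the top element conjugates a
generator; after `N` passes with `c ^ N = 1` nothing has changed. -/
lemma gen_mul_top (u : L.Simple c) : gen u * top L c = top L c * gen u.compl.compl := by
  conv_lhs => rw [← gen_mul_gen_compl u.compl, ← mul_assoc, gen_mul_gen_compl]

lemma gen_mul_top_pow (k : ℕ) (u : L.Simple c) :
    ∃ v : L.Simple c, v.1 = (c ^ k)⁻¹ * u.1 * c ^ k ∧
      gen u * top L c ^ k = top L c ^ k * gen v := by
  induction k with
  | zero => exact ⟨u, by simp, by simp⟩
  | succ k ih =>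
    obtain ⟨v, hv, h⟩ := ih
    refine ⟨v.compl.compl, ?_, ?_⟩
    · simp only [Simple.compl, hv, pow_succ]
      group
    · rw [pow_succ, ← mul_assoc, h, mul_assoc, gen_mul_top, ← mul_assoc]

lemma commute_top_pow {N : ℕ} (hN : c ^ N = 1) (P : L.IntervalMonoid c) :
    P * top L c ^ N = top L c ^ N * P := by
  induction P using IntervalMonoid.induction with
  | h1 => simp
  | hmul u P ih =>
    obtain ⟨v, hv, h⟩ := gen_mul_top_pow N u
    have : v = u := Subtype.ext (by simpa [hN] using hv)
    subst this
    rw [mul_assoc, ih, ← mul_assoc, h, mul_assoc]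

variable [hM : L.IsMeetInterval c]

lemma top_pow_mul_left_cancel (N : ℕ) {P Q : L.IntervalMonoid c}
    (h : top L c ^ N * P = top L c ^ N * Q) : P = Q := by
  induction N generalizing P Q with
  | zero => simpa using h
  | succ k ih =>
    rw [pow_succ, mul_assoc, mul_assoc] at h
    exact gen_mul_left_cancel (u := ⟨c, le_refl c⟩) (ih h)

lemma exists_mul_eq_top_pow {N : ℕ} (hN : c ^ N = 1) (h0 : N ≠ 0) (u : L.Simple c) :
    ∃ X, gen u * X = top L c ^ N ∧ X * gen u = top L c ^ N := by
  obtain ⟨k, rfl⟩ := Nat.exists_eq_succ_of_ne_zero h0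
  have h : gen u * (gen u.compl * top L c ^ k) = top L c ^ (k + 1) := by
    rw [← mul_assoc, gen_mul_gen_compl, pow_succ']
  refine ⟨_, h, gen_mul_left_cancel (u := u) ?_⟩
  rw [← mul_assoc, h]
  exact (commute_top_pow hN (gen u)).symm

/-- If `c` has finite order, then the interval monoid of `c` embeds into a group. -/
theorem exists_injective_hom_group {N : ℕ} (hN : c ^ N = 1) (h0 : N ≠ 0) :
    ∃ (G : Type u) (_ : Group G) (f : L.IntervalMonoid c →* G), Function.Injective f := by
  let S : Submonoid (L.IntervalMonoid c) := Submonoid.powers (top L c ^ N)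
  have hS : ∀ s ∈ S, ∃ k, c ^ k = 1 ∧ s = top L c ^ k := by
    rintro _ ⟨k, rfl⟩
    exact ⟨N * k, by rw [pow_mul, hN, one_pow], (pow_mul _ _ _).symm⟩
  have hcomm : ∀ (P : L.IntervalMonoid c) (s : S), P * s = s * P := by
    rintro P ⟨s, hs⟩
    obtain ⟨k, hk, rfl⟩ := hS s hs
    exact commute_top_pow hk P
  -- The denominators are powers of a central element, so the Ore condition holds with numerator and
  -- denominator unchanged.
  let _ : OreLocalization.OreSet S :=
    { ore_right_cancel := fun r₁ r₂ s h => ⟨s, by rw [← hcomm, ← hcomm, h]⟩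
      oreNum := fun r _ => r
      oreDenom := fun _ s => s
      ore_eq := fun r s => (hcomm r s).symm }
  let f : L.IntervalMonoid c →* OreLocalization S (L.IntervalMonoid c) :=
    OreLocalization.numeratorHom
  have hf : Function.Injective f := by
    intro P Q h
    simp only [f, OreLocalization.numeratorHom_apply, OreLocalization.oreDiv_eq_iff] at h
    obtain ⟨u, v, h₁, h₂⟩ := h
    simp only [Submonoid.coe_one, mul_one] at h₂
    rw [← h₂] at h₁
    obtain ⟨k, -, hk⟩ := hS u u.2
    rw [Submonoid.smul_def, smul_eq_mul, smul_eq_mul, hk] at h₁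
    exact (top_pow_mul_left_cancel k h₁).symm
  -- Every generator divides the inverted power of the top element on both sides, so the whole
  -- monoid lands in the units.
  have hunit : ∀ P, IsUnit (f P) := by
    intro P
    induction P using IntervalMonoid.induction with
    | h1 => simp
    | hmul u P ih =>
      rw [map_mul]
      refine IsUnit.mul ?_ ih
      obtain ⟨X, h₁, h₂⟩ := exists_mul_eq_top_pow hN h0 u
      obtain ⟨z, hz⟩ : IsUnit (f (top L c ^ N)) :=
        OreLocalization.numerator_isUnit ⟨top L c ^ N, Submonoid.mem_powers _⟩
      rw [isUnit_iff_exists_and_exists]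
      refine ⟨⟨f X * ↑z⁻¹, ?_⟩, ⟨↑z⁻¹ * f X, ?_⟩⟩
      · rw [← mul_assoc, ← map_mul, h₁, ← hz, Units.mul_inv]
      · rw [mul_assoc, ← map_mul, h₂, ← hz, Units.inv_mul]
  refine ⟨(OreLocalization S (L.IntervalMonoid c))ˣ, inferInstance,
    { toFun := fun P => (hunit P).unit
      map_one' := Units.ext (by simp)
      map_mul' := fun P Q => Units.ext (by simp) }, fun P Q h => hf ?_⟩
  exact congrArg Units.val h

end LengthFunction

end BandBraid
namespace BandBraid

open Equiv Equiv.Perm Module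

/-! ### The absolute length on permutations. -/

section PermLength

set_option linter.unusedSectionVars false

variable {α : Type*} [Fintype α] [DecidableEq α]

/-- The functions which are constant along the cycles of `w`. -/
def fixSpace (w : Perm α) : Submodule ℚ (α → ℚ) where
  carrier := {f | ∀ i, f (w i) = f i}
  add_mem' hf hg i := by simp [hf i, hg i]
  zero_mem' i := rfl
  smul_mem' r f hf i := by simp [hf i]

lemma mem_fixSpace {w : Perm α} {f : α → ℚ} : f ∈ fixSpace w ↔ ∀ i, f (w i) = f i := Iff.rfl

lemma eq_of_mem_fixSpace {w : Perm α} {f : α → ℚ} (hf : f ∈ fixSpace w) {i j : α}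
    (h : w.SameCycle i j) : f i = f j := by
  obtain ⟨k, rfl⟩ := h.exists_nat_pow_eq
  clear h
  induction k with
  | zero => rfl
  | succ k ih => rw [ih, pow_succ', mul_apply, hf]

lemma exists_mem_fixSpace (w : Perm α) (i : α) :
    ∃ f ∈ fixSpace w, ∀ j, f j = f i ↔ w.SameCycle i j := by
  classical
  refine ⟨fun j => if w.SameCycle i j then 1 else 0, fun j => by simp, fun j => ?_⟩
  by_cases h : w.SameCycle i j <;> simp [h, SameCycle.refl]

lemma fixSpace_inf_le (u v : Perm α) : fixSpace u ⊓ fixSpace v ≤ fixSpace (u * v) := by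
  rintro f ⟨hu, hv⟩ i
  rw [mul_apply, hu, hv]

lemma finrank_fixSpace_le (w : Perm α) : finrank ℚ (fixSpace w) ≤ Fintype.card α := by
  simpa using Submodule.finrank_le (fixSpace w)

lemma finrank_fixSpace_add_le (u v : Perm α) :
    finrank ℚ (fixSpace u) + finrank ℚ (fixSpace v) ≤
      Fintype.card α + finrank ℚ ↥(fixSpace u ⊓ fixSpace v) := by
  have h1 := Submodule.finrank_sup_add_finrank_inf_eq (fixSpace u) (fixSpace v)
  have h2 : finrank ℚ ↥(fixSpace u ⊔ fixSpace v) ≤ Fintype.card α := by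
    simpa using Submodule.finrank_le (fixSpace u ⊔ fixSpace v)
  omega

/-- The codimension of the fixed space, as a length function on a permutation group. -/
noncomputable def permLength (α : Type*) [Fintype α] [DecidableEq α] :
    LengthFunction (Perm α) where
  len w := Fintype.card α - finrank ℚ (fixSpace w)
  len_eq_zero g := by
    have hle := finrank_fixSpace_le g
    constructor
    · intro h
      have htop : fixSpace g = ⊤ := by
        apply Submodule.eq_top_of_finrank_eq
        rw [Module.finrank_fintype_fun_eq_card]
        omega
      ext i
      have : Pi.single i (1 : ℚ) ∈ fixSpace g := htop ▸ Submodule.mem_top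
      have := this i
      simp only [Pi.single_apply, if_true] at this
      simpa using this
    · rintro rfl
      have htop : fixSpace (1 : Perm α) = ⊤ := by
        rw [eq_top_iff]; intro f _ i; rfl
      rw [htop, finrank_top, Module.finrank_fintype_fun_eq_card, Nat.sub_self]
  len_mul_le g h := by
    have h1 := Submodule.finrank_mono (fixSpace_inf_le g h)
    have h2 := finrank_fixSpace_add_le g h
    have h3 := finrank_fixSpace_le g
    have h4 := finrank_fixSpace_le h
    omega
  len_conj g h := by
    have : fixSpace (h * g * h⁻¹) =
        (fixSpace g).map (LinearEquiv.funCongrLeft ℚ ℚ h).symm.toLinearMap := by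
      rw [Submodule.map_equiv_eq_comap_symm]
      ext f
      simp only [mem_fixSpace, Submodule.mem_comap]
      constructor
      · intro hf i
        simpa [LinearEquiv.funCongrLeft, LinearMap.funLeft] using hf (h i)
      · intro hf i
        simpa [LinearEquiv.funCongrLeft, LinearMap.funLeft] using hf (h⁻¹ i)
    rw [this, LinearEquiv.finrank_map_eq]

/-- Equality of lengths is a dimension count that forces the inclusion of `fixSpace_inf_le` to be an
equality. -/
lemma fixSpace_le_of_le {u w : Perm α} (h : (permLength α).Le u w) :
    fixSpace w ≤ fixSpace u := by
  have hle : fixSpace u ⊓ fixSpace (u⁻¹ * w) ≤ fixSpace w := by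
    simpa using fixSpace_inf_le u (u⁻¹ * w)
  have h1 := finrank_fixSpace_add_le u (u⁻¹ * w)
  have h2 := finrank_fixSpace_le u
  have h3 := finrank_fixSpace_le w
  have h4 := finrank_fixSpace_le (u⁻¹ * w)
  have h5 : (Fintype.card α - finrank ℚ (fixSpace u)) +
    (Fintype.card α - finrank ℚ (fixSpace (u⁻¹ * w))) =
    Fintype.card α - finrank ℚ (fixSpace w) := h
  have := Submodule.eq_of_le_of_finrank_le hle (by omega)
  rw [← this]
  exact inf_le_left

lemma sameCycle_of_le {u w : Perm α} (h : (permLength α).Le u w) {i j : α}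
    (hu : u.SameCycle i j) : w.SameCycle i j := by
  obtain ⟨f, hf, hf'⟩ := exists_mem_fixSpace w i
  rw [← hf']
  exact (eq_of_mem_fixSpace (fixSpace_le_of_le h hf) hu).symm

lemma sameCycle_swap (i j : α) : (swap i j).SameCycle i j := ⟨1, by simp⟩

lemma mem_fixSpace_swap {i j : α} {f : α → ℚ} (h : f i = f j) : f ∈ fixSpace (swap i j) := by
  intro k
  rcases eq_or_ne k i with rfl | hi
  · simp [h]
  · rcases eq_or_ne k j with rfl | hj
    · simp [h]
    · rw [swap_apply_of_ne_of_ne hi hj]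

/-- Let `m` be the first time `w` carries `i` to `j`. At that step the new permutation returns to
`i` instead, so its orbit of `i` consists of iterates `w ^ l` with `l < m` and misses `j`. -/
lemma not_sameCycle_swap_mul {w : Perm α} {i j : α} (hij : i ≠ j) (h : w.SameCycle i j) :
    ¬ (swap i j * w).SameCycle i j := by
  have hex : ∃ k, (w ^ k) i = j := h.exists_nat_pow_eq
  classical
  set m := Nat.find hex with hm
  have hmj : (w ^ m) i = j := Nat.find_spec hex
  have hmin : ∀ k < m, (w ^ k) i ≠ j := fun k hk => Nat.find_min hex hk
  have hm0 : 0 < m := by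
    rcases Nat.eq_zero_or_pos m with h0 | h0
    · rw [h0] at hmj; exact absurd hmj hij
    · exact h0
  have hret : ∀ k, 0 < k → k < m → (w ^ k) i ≠ i := by
    intro k hk hkm hki
    refine hmin (m - k) (by omega) ?_
    rw [← hmj]
    conv_rhs => rw [show m = (m - k) + k by omega, pow_add, mul_apply, hki]
  have hpow : ∀ k, ∃ l < m, ((swap i j * w) ^ k) i = (w ^ l) i := by
    intro k
    induction k with
    | zero => exact ⟨0, hm0, rfl⟩
    | succ k ih =>
      obtain ⟨l, hl, e⟩ := ih
      rw [pow_succ', mul_apply, e, mul_apply, ← mul_apply w, ← pow_succ']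
      rcases Nat.lt_or_ge (l + 1) m with h1 | h1
      · exact ⟨l + 1, h1, swap_apply_of_ne_of_ne (hret _ (by omega) h1) (hmin _ h1)⟩
      · rw [show l + 1 = m by omega, hmj, swap_apply_right]
        exact ⟨0, hm0, rfl⟩
  intro hs
  obtain ⟨k, hk⟩ := hs.exists_nat_pow_eq
  obtain ⟨l, hl, e⟩ := hpow k
  exact hmin l hl (e.symm.trans hk)

lemma len_swap {i j : α} (hij : i ≠ j) : (permLength α).len (swap i j) = 1 := by
  have h1 : (permLength α).len (swap i j) ≠ 0 := by
    rw [Ne, LengthFunction.len_eq_zero, swap_eq_one_iff]; exact hij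
  have h2 : (permLength α).len (swap i j) ≤ 1 := by
    change Fintype.card α - finrank ℚ (fixSpace (swap i j)) ≤ 1
    let φ : (α → ℚ) →ₗ[ℚ] ℚ := LinearMap.proj i - LinearMap.proj (R := ℚ) (φ := fun _ : α => ℚ) j
    have hφ : LinearMap.ker φ ≤ fixSpace (swap i j) := by
      intro f hf
      exact mem_fixSpace_swap (sub_eq_zero.1 (by simpa [φ] using hf))
    have h3 := Submodule.finrank_mono hφ
    have h4 := LinearMap.finrank_range_add_finrank_ker φ
    have h5 := Submodule.finrank_le (LinearMap.range φ)
    rw [Module.finrank_self] at h5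
    rw [Module.finrank_fintype_fun_eq_card] at h4
    omega
  omega

/-- A transposition lies below `w` exactly if its two points are in one cycle of `w`. -/
lemma swap_le_iff {w : Perm α} {i j : α} (hij : i ≠ j) :
    (permLength α).Le (swap i j) w ↔ w.SameCycle i j := by
  refine ⟨fun h => sameCycle_of_le h (sameCycle_swap i j), fun h => ?_⟩
  unfold LengthFunction.Le
  rw [len_swap hij, swap_inv]
  have h1 : (permLength α).len w ≤ 1 + (permLength α).len (swap i j * w) := by
    have := (permLength α).len_mul_le (swap i j) (swap i j * w)
    rwa [swap_mul_self_mul, len_swap hij] at this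
  -- The fixed space grows strictly: the function supplied by the cycle of `i` in the product
  -- separates `i` from `j`, while functions fixed by `w` do not.
  have h2 : (permLength α).len (swap i j * w) < (permLength α).len w := by
    have hlt : fixSpace w < fixSpace (swap i j * w) := by
      refine lt_of_le_of_ne (fun f hf => fixSpace_inf_le _ _
        ⟨mem_fixSpace_swap (eq_of_mem_fixSpace hf h), hf⟩) fun he => ?_
      obtain ⟨f, hf, hf'⟩ := exists_mem_fixSpace (swap i j * w) i
      rw [← he] at hf
      exact not_sameCycle_swap_mul hij h ((hf' j).1 (eq_of_mem_fixSpace hf h).symm)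
    have h3 := Submodule.finrank_lt_finrank_of_lt hlt
    have h4 := finrank_fixSpace_le (swap i j * w)
    change Fintype.card α - _ < Fintype.card α - _
    omega
  omega

lemma exists_swap_le {w : Perm α} (hw : w ≠ 1) :
    ∃ i j, i ≠ j ∧ (permLength α).Le (swap i j) w := by
  obtain ⟨i, hi⟩ : ∃ i, w i ≠ i := by
    by_contra! h
    exact hw (Equiv.ext h)
  exact ⟨i, w i, hi.symm, (swap_le_iff hi.symm).2 ⟨1, by simp⟩⟩

/-- Multiplying by a transposition only affects the cycles through its two points. -/
lemma sameCycle_swap_mul_or {w : Perm α} {i j k l : α} (h : w.SameCycle k l) :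
    (swap i j * w).SameCycle k l ∨ (swap i j * w).SameCycle i l ∨
      (swap i j * w).SameCycle j l := by
  obtain ⟨m, rfl⟩ := h.exists_nat_pow_eq
  clear h
  induction m with
  | zero => exact Or.inl (SameCycle.refl _ _)
  | succ m ih =>
    rw [pow_succ', mul_apply]
    set b := (w ^ m) k
    by_cases hi : w b = i
    · rw [hi]; exact Or.inr (Or.inl (SameCycle.refl _ _))
    by_cases hj : w b = j
    · rw [hj]; exact Or.inr (Or.inr (SameCycle.refl _ _))
    have hb : (swap i j * w) b = w b := by
      rw [mul_apply, swap_apply_of_ne_of_ne hi hj]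
    rw [← hb]
    simpa only [sameCycle_apply_right] using ih

end PermLength

end BandBraid
namespace BandBraid

/-! ### Meets in an interval from joins of atoms. -/

namespace LengthFunction

variable {Γ : Type*} [Group Γ] {L : LengthFunction Γ} {c : Γ}

variable (L c) in
/-- `j` is the least upper bound of `a` and `b` in the interval `[1, c]`. -/
def IsJoin (a b j : Γ) : Prop :=
  L.Le j c ∧ L.Le a j ∧ L.Le b j ∧ ∀ z, L.Le z c → L.Le a z → L.Le b z → L.Le j z

lemma IsJoin.symm {a b j : Γ} (h : L.IsJoin c a b j) : L.IsJoin c b a j :=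
  ⟨h.1, h.2.2.1, h.2.1, fun z hz hb ha => h.2.2.2 z hz ha hb⟩

lemma isJoin_of_le {a b : Γ} (hb : L.Le b c) (hab : L.Le a b) : L.IsJoin c a b b :=
  ⟨hb, hab, le_refl b, fun _ _ _ h => h⟩

/-- If two elements of length one always have a join below `c`, then all elements do. -/
lemma exists_join_of_atoms (hatom : ∀ u, u ≠ 1 → ∃ x, L.len x = 1 ∧ L.Le x u)
    (hjoin : ∀ x y, L.len x = 1 → L.len y = 1 → L.Le x c → L.Le y c → ∃ j, L.IsJoin c x y j)
    {v a b : Γ} (hva : L.Le v a) (hvb : L.Le v b) (ha : L.Le a c) (hb : L.Le b c) :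
    ∃ j, L.IsJoin c a b j := by
  induction hk : L.len c - L.len v using Nat.strong_induction_on generalizing v a b with
  | _ k ih =>
  by_cases hav : v = a
  · exact ⟨b, isJoin_of_le hb (hav ▸ hvb)⟩
  by_cases hbv : v = b
  · exact ⟨a, (isJoin_of_le ha (hbv ▸ hva)).symm⟩
  obtain ⟨x, hx, hxa⟩ := hatom (v⁻¹ * a) (by rwa [Ne, inv_mul_eq_one])
  obtain ⟨y, hy, hyb⟩ := hatom (v⁻¹ * b) (by rwa [Ne, inv_mul_eq_one])
  have hv : L.Le v c := le_trans hva ha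
  have hxc : L.Le x (v⁻¹ * c) := le_trans hxa ((inv_mul_le_inv_mul_iff hva hv).2 ha)
  have hyc : L.Le y (v⁻¹ * c) := le_trans hyb ((inv_mul_le_inv_mul_iff hvb hv).2 hb)
  have hdc : L.Le (v⁻¹ * c) c := inv_mul_le hv
  obtain ⟨j, hjc, hxj, hyj, hj⟩ := hjoin x y hx hy (le_trans hxc hdc) (le_trans hyc hdc)
  have hjd := hj _ hdc hxc hyc
  obtain ⟨hvx, hvxa⟩ := mul_le_of_le_inv_mul hva hxa
  obtain ⟨hvy, hvyb⟩ := mul_le_of_le_inv_mul hvb hyb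
  obtain ⟨hvj, hvjc⟩ := mul_le_of_le_inv_mul hv hjd
  have hxvj := (mul_le_mul_iff hvx hvj).2 hxj
  have hyvj := (mul_le_mul_iff hvy hvj).2 hyj
  have hlx := (le_mul_iff (L := L)).1 hvx
  have hly := (le_mul_iff (L := L)).1 hvy
  have hlxc := len_le_of_le (le_trans hvxa ha)
  have hlyc := len_le_of_le (le_trans hvyb hb)
  -- With `j` the join of the two atoms above `v`, join `a` with `v j` over `v x`, then `b` with `v
  -- j` over `v y`, then the two results over `v j`. Each base point is longer than `v`, so
  -- induction applies.
  obtain ⟨p, hpc, hap, hjp, hp⟩ := ih _ (by omega) hvxa hxvj ha hvjc rfl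
  obtain ⟨q, hqc, hbq, hjq, hq⟩ := ih _ (by omega) hvyb hyvj hb hvjc rfl
  obtain ⟨r, hrc, hpr, hqr, hr⟩ :=
    ih _ (by omega) (le_trans hxvj hjp) (le_trans hxvj hjq) hpc hqc rfl
  refine ⟨r, hrc, le_trans hap hpr, le_trans hbq hqr, fun z hz haz hbz => ?_⟩
  have hvz := le_trans hva haz
  have hxz : L.Le x (v⁻¹ * z) := le_trans hxa ((inv_mul_le_inv_mul_iff hva hvz).2 haz)
  have hyz : L.Le y (v⁻¹ * z) := le_trans hyb ((inv_mul_le_inv_mul_iff hvb hvz).2 hbz)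
  have hjz := hj _ (le_trans (inv_mul_le hvz) hz) hxz hyz
  have hvjz := (mul_le_of_le_inv_mul hvz hjz).2
  exact hr z hz (hp z hz haz hvjz) (hq z hz hbz hvjz)

/-- If two elements of length one always have a join below `c`, then `[1, c]` has meets. -/
lemma isMeetInterval_of_atoms (hatom : ∀ u, u ≠ 1 → ∃ x, L.len x = 1 ∧ L.Le x u)
    (hjoin : ∀ x y, L.len x = 1 → L.len y = 1 → L.Le x c → L.Le y c → ∃ j, L.IsJoin c x y j) :
    L.IsMeetInterval c := by
  refine ⟨fun u v hu hv => ?_⟩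
  let S : Set ℕ := {k | ∃ b, L.Le b u ∧ L.Le b v ∧ L.len b = k}
  have hne : S.Nonempty := ⟨_, 1, one_le u, one_le v, rfl⟩
  have hbd : BddAbove S := ⟨L.len u, by rintro _ ⟨b, hb, -, rfl⟩; exact len_le_of_le hb⟩
  obtain ⟨m, hmu, hmv, hm⟩ := Nat.sSup_mem hne hbd
  refine ⟨m, hmu, hmv, fun b hbu hbv => ?_⟩
  -- Here `m` is a longest common lower bound. Its join with `b` is again a common lower bound,
  -- hence equals `m`.
  obtain ⟨j, -, hmj, hbj, hj⟩ := exists_join_of_atoms hatom hjoin (one_le m) (one_le b)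
    (le_trans hmu hu) (le_trans hbu hu)
  have hle : L.len j ≤ L.len m := by
    rw [hm]
    exact le_csSup hbd ⟨j, hj u hu hmu hbu, hj v hv hmv hbv, rfl⟩
  rw [eq_of_le_of_len_le hmj hle]
  exact hbj

/-- In a meet interval whose atoms are involutions an element is determined by the atoms below it. -/
lemma le_of_atoms_le [hM : L.IsMeetInterval c]
    (hatom : ∀ u, u ≠ 1 → ∃ x, L.len x = 1 ∧ L.Le x u)
    (hinv : ∀ x, L.len x = 1 → x * x = 1) {u v : Γ} (hu : L.Le u c)
    (hv : L.Le v c) (h : ∀ x, L.len x = 1 → L.Le x u → L.Le x v) : L.Le u v := by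
  obtain ⟨m, hmu, hmv, hm⟩ := hM.exists_inf u v hu hv
  by_cases hne : m = u
  · exact hne ▸ hmv
  obtain ⟨x, hx, hxu⟩ := hatom (m⁻¹ * u) (by rwa [Ne, inv_mul_eq_one])
  obtain ⟨h1, h2⟩ := mul_le_of_le_inv_mul hmu hxu
  have hxm : L.Le x m := by
    have hxu' := le_trans (le_of_geodesic_right h1) h2
    exact hm x hxu' (h x hx hxu')
  -- The atom `x` lengthens `m` on the right; but `x` also lies below `m`, so, being an involution,
  -- it would shorten it.
  have hxx : x⁻¹ = x := inv_eq_of_mul_eq_one_left (hinv x hx)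
  unfold Le at hxm
  rw [le_mul_iff] at h1
  rw [hxx, len_mul_comm] at hxm
  omega

end LengthFunction

open Equiv Equiv.Perm LengthFunction

/-! ### The interval below the n-cycle: noncrossing permutations. -/

section DescCycle

variable {n : ℕ}

/-- The cycle `(n, n - 1, …, 1)`. -/
def descCycle (n : ℕ) : Perm (Fin n) := List.formPerm (List.finRange n).reverse

lemma sameCycle_formPerm {l : List (Fin n)} (hl : l.Nodup) (hn : 2 ≤ l.length) {i j : Fin n}
    (hi : i ∈ l) (hj : j ∈ l) : l.formPerm.SameCycle i j :=
  (List.isCycle_formPerm hl hn).sameCycle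
    ((List.formPerm_apply_mem_ne_self_iff l hl i hi).2 hn)
    ((List.formPerm_apply_mem_ne_self_iff l hl j hj).2 hn)

lemma descCycle_sameCycle (i j : Fin n) : (descCycle n).SameCycle i j := by
  rcases Nat.lt_or_ge n 2 with hn | hn
  · have : i = j := by ext; omega
    rw [this]
  · exact sameCycle_formPerm (List.nodup_reverse.2 (List.nodup_finRange n)) (by simpa using hn)
      (by simp) (by simp)

lemma descCycle_symm_val (i : Fin n) : ((descCycle n).symm i : ℕ) = (i + 1) % n := by
  have h : (descCycle n).symm = List.formPerm (List.finRange n) := by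
    rw [descCycle, List.formPerm_reverse]; exact inv_inv _
  rw [h]
  have := List.formPerm_apply_getElem (List.finRange n) (List.nodup_finRange n) i (by simp)
  simp only [List.getElem_finRange, List.length_finRange] at this
  simpa using congrArg Fin.val this

/-- The points of the half-open interval cut out by the transposition of `s < t`. -/
def Window (t s i : Fin n) : Prop := s < i ∧ i ≤ t

/-- The n-cycle sends `j + 1` to `j` modulo `n`. Following it by the transposition diverts `s + 1`
to `t` and the successor of `t` to `s`, which separates the window from its complement. -/
lemma window_swap_mul_descCycle {t s : Fin n} (h : s < t) (i : Fin n) :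
    Window t s ((swap t s * descCycle n) i) ↔ Window t s i := by
  obtain ⟨j, rfl⟩ := (descCycle n).symm.surjective i
  rw [mul_apply, apply_symm_apply]
  have hv := descCycle_symm_val j
  simp only [Window, Fin.lt_def, Fin.le_def, hv]
  have hmod : (j.1 + 1 = n ∧ (j.1 + 1) % n = 0) ∨ (j.1 + 1 < n ∧ (j.1 + 1) % n = j.1 + 1) := by
    rcases Nat.lt_or_ge (j.1 + 1) n with h1 | h1
    · exact Or.inr ⟨h1, Nat.mod_eq_of_lt h1⟩
    · have : j.1 + 1 = n := by omega
      exact Or.inl ⟨this, by rw [this, Nat.mod_self]⟩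
  have ht := t.2
  rcases eq_or_ne j t with rfl | hjt
  · rw [swap_apply_left]; omega
  rcases eq_or_ne j s with rfl | hjs
  · rw [swap_apply_right]; omega
  rw [swap_apply_of_ne_of_ne hjt hjs]
  have h1 : j.1 ≠ t.1 := fun e => hjt (Fin.ext e)
  have h2 : j.1 ≠ s.1 := fun e => hjs (Fin.ext e)
  omega

lemma window_iff_of_sameCycle {t s i j : Fin n} (h : s < t)
    (hij : (swap t s * descCycle n).SameCycle i j) : Window t s i ↔ Window t s j := by
  obtain ⟨k, rfl⟩ := hij.exists_nat_pow_eq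
  clear hij
  induction k with
  | zero => rfl
  | succ k ih => rw [ih, pow_succ', mul_apply, window_swap_mul_descCycle h]

lemma swap_le_descCycle {t s : Fin n} (h : t ≠ s) :
    (permLength _).Le (swap t s) (descCycle n) :=
  (swap_le_iff h).2 (descCycle_sameCycle t s)

lemma window_left {t s : Fin n} (h : s < t) : Window t s t := ⟨h, _root_.le_refl _⟩

lemma not_window_right {t s : Fin n} : ¬ Window t s s := fun h => lt_irrefl _ h.1

lemma swap_mul_le_swap_mul {t s : Fin n} (h : s < t) {z : Perm (Fin n)}
    (hz : (permLength _).Le z (descCycle n)) (hts : (permLength _).Le (swap t s) z) :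
    (permLength _).Le (swap t s * z) (swap t s * descCycle n) := by
  have := (inv_mul_le_inv_mul_iff hts (swap_le_descCycle h.ne')).2 hz
  simpa using this

lemma swap_mul_le {t s : Fin n} {z : Perm (Fin n)} (hts : (permLength _).Le (swap t s) z) :
    (permLength _).Le (swap t s * z) z := by
  simpa using inv_mul_le hts

/-- A transposition below `z` not separated by `(t s) ≤ z` lies below the complement of `(t s)`. -/
lemma swap_le_swap_mul {t s r q : Fin n} (h : s < t) (hrq : r ≠ q) {z : Perm (Fin n)}
    (hz : (permLength _).Le z (descCycle n)) (hts : (permLength _).Le (swap t s) z)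
    (hw : Window t s r ↔ Window t s q) (hle : (permLength _).Le (swap r q) z) :
    (permLength _).Le (swap r q) (swap t s * z) := by
  have hzc := swap_mul_le_swap_mul h hz hts
  have key : ∀ {i j}, (swap t s * z).SameCycle i j → (Window t s i ↔ Window t s j) :=
    fun hij => window_iff_of_sameCycle h (sameCycle_of_le hzc hij)
  rw [swap_le_iff hrq] at hle ⊢
  have ht := window_left h
  have hs := not_window_right (t := t) (s := s)
  -- If `r` and `q` were separated, one would join the cycle of `t` and the other that of `s`; these
  -- lie on opposite sides of the window, whereas `r` and `q` lie on the same side.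
  rcases sameCycle_swap_mul_or (i := t) (j := s) hle with h1 | h1 | h1
  · exact h1
  all_goals
    rcases sameCycle_swap_mul_or (i := t) (j := s) hle.symm with h2 | h2 | h2
  · exact h2.symm
  · exact h2.symm.trans h1
  · have := key h1; have := key h2; tauto
  · exact h2.symm
  · have := key h1; have := key h2; tauto
  · exact h2.symm.trans h1

lemma swap_le_swap_mul_descCycle_iff {t s r q : Fin n} (h : s < t) (hrq : r ≠ q) :
    (permLength _).Le (swap r q) (swap t s * descCycle n) ↔ (Window t s r ↔ Window t s q) := by
  constructor
  · intro hle
    exact window_iff_of_sameCycle h ((swap_le_iff hrq).1 hle)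
  · intro hw
    exact swap_le_swap_mul h hrq (LengthFunction.le_refl _) (swap_le_descCycle h.ne') hw
      (swap_le_descCycle hrq)

/-- Anything above both transpositions still has the second below it once the first is divided out,
by `swap_le_swap_mul`. -/
lemma isJoin_of_window {t s r q : Fin n} (h : s < t) (hrq : r ≠ q)
    (hw : Window t s r ↔ Window t s q) :
    (permLength _).IsJoin (descCycle n) (swap t s) (swap r q) (swap t s * swap r q) := by
  have hts := swap_le_descCycle h.ne'
  have h1 : (permLength _).Le (swap r q) ((swap t s)⁻¹ * descCycle n) := by
    simpa using (swap_le_swap_mul_descCycle_iff h hrq).2 hw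
  obtain ⟨h2, h3⟩ := mul_le_of_le_inv_mul hts h1
  refine ⟨h3, h2, le_of_geodesic_right h2, fun z hz htz hrz => ?_⟩
  refine (mul_le_of_le_inv_mul htz ?_).2
  simpa using swap_le_swap_mul h hrq hz htz hw hrz

/-- If two crossing transpositions lie below `z`, then so does the one joining the upper points. -/
lemma sameCycle_of_crossing {t r s q : Fin n} (hrt : r < t) (hsr : s < r) (hqs : q < s)
    {z : Perm (Fin n)} (hz : (permLength _).Le z (descCycle n))
    (hts : (permLength _).Le (swap t s) z) (hrq : (permLength _).Le (swap r q) z) :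
    z.SameCycle t r ∧ z.SameCycle r s ∧ z.SameCycle s q := by
  have h : s < t := hsr.trans hrt
  have hzc := swap_mul_le_swap_mul h hz hts
  have key : ∀ {i j}, (swap t s * z).SameCycle i j → (Window t s i ↔ Window t s j) :=
    fun hij => window_iff_of_sameCycle h (sameCycle_of_le hzc hij)
  have hq : ¬ Window t s q := fun hq => lt_asymm hq.1 hqs
  have hr : Window t s r := ⟨hsr, hrt.le⟩
  have hrq' := (swap_le_iff (hqs.trans hsr).ne').1 hrq
  have hts' := (swap_le_iff h.ne').1 hts
  -- The window separates `q` from both `r` and `t`, so after the cut `q` can only remain with `s`.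
  have hsq : z.SameCycle s q := by
    rcases sameCycle_swap_mul_or (i := t) (j := s) hrq' with h1 | h1 | h1
    · exact absurd ((key h1).1 hr) hq
    · exact absurd ((key h1).1 (window_left h)) hq
    · exact sameCycle_of_le (swap_mul_le hts) h1
  have hrs := hrq'.trans hsq.symm
  exact ⟨hts'.trans hrs.symm, hrs, hsq⟩

/-- Any upper bound has all four points in one cycle. Splitting off `(t r)` leaves `r`, `s`, `q`
together, so the join is `(t r)` times the join of `(r s)` and `(s q)`. -/
lemma exists_isJoin_of_crossing {t r s q : Fin n} (hrt : r < t) (hsr : s < r) (hqs : q < s) :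
    ∃ j, (permLength _).IsJoin (descCycle n) (swap t s) (swap r q) j := by
  obtain ⟨hkc, hrk, hsk, hk⟩ := isJoin_of_window (t := r) (s := s) (r := s) (q := q) hsr hqs.ne'
    (by simp only [Window, Fin.lt_def, Fin.le_def] at *; omega)
  set k := swap r s * swap s q
  have hbelow : ∀ z, (permLength _).Le z (descCycle n) → (permLength _).Le (swap t s) z →
      (permLength _).Le (swap r q) z →
      (permLength _).Le (swap t r) z ∧ (permLength _).Le k ((swap t r)⁻¹ * z) := by
    intro z hz hts hrq
    obtain ⟨h1, h2, h3⟩ := sameCycle_of_crossing hrt hsr hqs hz hts hrq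
    have htr := (swap_le_iff hrt.ne').2 h1
    refine ⟨htr, ?_⟩
    rw [swap_inv]
    refine hk _ (le_trans (swap_mul_le htr) hz) ?_ ?_
    · exact swap_le_swap_mul hrt hsr.ne' hz htr
        (by simp only [Window, Fin.lt_def, Fin.le_def] at *; omega) ((swap_le_iff hsr.ne').2 h2)
    · exact swap_le_swap_mul hrt hqs.ne' hz htr
        (by simp only [Window, Fin.lt_def, Fin.le_def] at *; omega) ((swap_le_iff hqs.ne').2 h3)
  obtain ⟨h1, h2⟩ := hbelow _ (LengthFunction.le_refl _) (swap_le_descCycle (hsr.trans hrt).ne')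
    (swap_le_descCycle (hqs.trans hsr).ne')
  obtain ⟨h3, h4⟩ := mul_le_of_le_inv_mul h1 h2
  have h5 := le_of_geodesic_right h3
  have ht := (swap_le_iff hrt.ne').1 h3
  have hr := (swap_le_iff hsr.ne').1 (le_trans hrk h5)
  have hs := (swap_le_iff hqs.ne').1 (le_trans hsk h5)
  refine ⟨swap t r * k, h4, (swap_le_iff (hsr.trans hrt).ne').2 (ht.trans hr),
    (swap_le_iff (hqs.trans hsr).ne').2 (hr.trans hs), fun z hz hts hrq => ?_⟩
  obtain ⟨h6, h7⟩ := hbelow z hz hts hrq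
  exact (mul_le_of_le_inv_mul h6 h7).2

/-- Two transpositions are equal, noncrossing in one of the two orders, or crossing. -/
lemma window_trichotomy {t s r q : Fin n} (h : s < t) (h' : q < r) :
    (t = r ∧ s = q) ∨ (Window t s r ↔ Window t s q) ∨ (Window r q t ↔ Window r q s) ∨
      (r < t ∧ s < r ∧ q < s) ∨ (t < r ∧ q < t ∧ s < q) := by
  simp only [Window, Fin.lt_def, Fin.le_def, Fin.ext_iff] at *
  omega

lemma exists_isJoin_swap {t s r q : Fin n} (h : s < t) (h' : q < r) :
    ∃ j, (permLength _).IsJoin (descCycle n) (swap t s) (swap r q) j := by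
  rcases window_trichotomy h h' with ⟨rfl, rfl⟩ | hw | hw | ⟨h1, h2, h3⟩ | ⟨h1, h2, h3⟩
  · exact ⟨_, isJoin_of_le (swap_le_descCycle h.ne') (LengthFunction.le_refl _)⟩
  · exact ⟨_, isJoin_of_window h h'.ne' hw⟩
  · exact ⟨_, (isJoin_of_window h' h.ne' hw).symm⟩
  · exact exists_isJoin_of_crossing h1 h2 h3
  · exact (exists_isJoin_of_crossing h1 h2 h3).imp fun _ => IsJoin.symm

lemma exists_lt_swap_eq {i j : Fin n} (h : i ≠ j) :
    ∃ t s : Fin n, s < t ∧ swap i j = swap t s := by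
  rcases lt_or_gt_of_ne h with h | h
  · exact ⟨j, i, h, swap_comm i j⟩
  · exact ⟨i, j, h, rfl⟩

lemma exists_atom_le {u : Perm (Fin n)} (hu : u ≠ 1) :
    ∃ t s : Fin n, s < t ∧ (permLength _).Le (swap t s) u := by
  obtain ⟨i, j, hij, hle⟩ := exists_swap_le hu
  obtain ⟨t, s, h, e⟩ := exists_lt_swap_eq hij
  exact ⟨t, s, h, e ▸ hle⟩

lemma exists_swap_of_len_eq_one {x : Perm (Fin n)} (hx : (permLength _).len x = 1) :
    ∃ t s : Fin n, s < t ∧ x = swap t s := by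
  have h1 : x ≠ 1 := by rintro rfl; simp at hx
  obtain ⟨t, s, h, hle⟩ := exists_atom_le h1
  exact ⟨t, s, h, (eq_of_le_of_len_le hle (by rw [hx, len_swap h.ne'])).symm⟩

lemma exists_len_one_le (u : Perm (Fin n)) (hu : u ≠ 1) :
    ∃ x, (permLength _).len x = 1 ∧ (permLength _).Le x u := by
  obtain ⟨t, s, h, hle⟩ := exists_atom_le hu
  exact ⟨_, len_swap h.ne', hle⟩

instance : (permLength (Fin n)).IsMeetInterval (descCycle n) := by
  refine isMeetInterval_of_atoms exists_len_one_le fun x y hx hy _ _ => ?_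
  obtain ⟨t, s, h, rfl⟩ := exists_swap_of_len_eq_one hx
  obtain ⟨r, q, h', rfl⟩ := exists_swap_of_len_eq_one hy
  exact exists_isJoin_swap h h'

/-- The order below `descCycle n` is detected by transpositions. -/
lemma le_of_swap_le {u v : Perm (Fin n)} (hu : (permLength _).Le u (descCycle n))
    (hv : (permLength _).Le v (descCycle n))
    (h : ∀ t s : Fin n, s < t → (permLength _).Le (swap t s) u → (permLength _).Le (swap t s) v) :
    (permLength _).Le u v := by
  refine le_of_atoms_le exists_len_one_le ?_ hu hv ?_
  · intro x hx
    obtain ⟨t, s, -, rfl⟩ := exists_swap_of_len_eq_one hx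
    simp
  · intro x hx hle
    obtain ⟨t, s, hts, rfl⟩ := exists_swap_of_len_eq_one hx
    exact h t s hts hle

end DescCycle

end BandBraid
namespace BandBraid

open Equiv

/-! ### Relations between band generators in the braid group. -/

section BandRelations

variable {n : ℕ}

lemma sigma_comm {k l : ℕ} (h : k + 1 < l) : Commute (sigma n k) (sigma n l) := by
  unfold sigma
  split_ifs with hk hl
  · have hm : (FreeGroup.of (⟨k, hk⟩ : Fin (n - 1)) * FreeGroup.of ⟨l, hl⟩) *
        (FreeGroup.of ⟨l, hl⟩ * FreeGroup.of ⟨k, hk⟩)⁻¹ ∈ artinRels n := by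
      refine Or.inl ⟨_, _, ?_, rfl⟩
      rw [lt_abs]
      right
      push_cast
      omega
    have := PresentedGroup.one_of_mem hm
    rwa [map_mul, map_inv, map_mul, map_mul, mul_inv_eq_one] at this
  all_goals simp

lemma sigma_braid {k : ℕ} (h : k + 2 < n) :
    sigma n k * sigma n (k + 1) * sigma n k = sigma n (k + 1) * sigma n k * sigma n (k + 1) := by
  unfold sigma
  rw [dif_pos (by omega), dif_pos (by omega)]
  have hm : (FreeGroup.of (⟨k, by omega⟩ : Fin (n - 1)) * FreeGroup.of ⟨k + 1, by omega⟩ *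
      FreeGroup.of ⟨k, by omega⟩) * (FreeGroup.of ⟨k + 1, by omega⟩ * FreeGroup.of ⟨k, by omega⟩ *
      FreeGroup.of ⟨k + 1, by omega⟩)⁻¹ ∈ artinRels n := by
    refine Or.inr ⟨_, _, ?_, rfl⟩
    push_cast
    rw [show (k : ℤ) - (k + 1) = -1 by ring]
    rfl
  have := PresentedGroup.one_of_mem hm
  simp only [map_mul, map_inv] at this
  exact mul_inv_eq_one.1 this

/-- The band generator `a_{ts}` with natural number indices. -/
def natBand (n t s : ℕ) : BraidGroup n := sigmaDown n t s * sigma n s * (sigmaDown n t s)⁻¹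

lemma band_eq_natBand (t s : Fin n) : band t s = natBand n t s := rfl

lemma natBand_succ_self (s : ℕ) : natBand n (s + 1) s = sigma n s := by
  simp [natBand, sigmaDown]

lemma natBand_succ {t s : ℕ} (h : s < t) :
    natBand n (t + 1) s = sigma n t * natBand n t s * (sigma n t)⁻¹ := by
  have : sigmaDown n (t + 1) s = sigma n t * sigmaDown n t s := by
    simp [sigmaDown, List.Ico.succ_top (Nat.succ_le_of_lt h)]
  rw [natBand, this, natBand]
  group

lemma commute_natBand {g : BraidGroup n} {t s : ℕ} (hst : s < t)
    (h : ∀ k, s ≤ k → k < t → Commute g (sigma n k)) : Commute g (natBand n t s) := by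
  induction t, hst using Nat.le_induction with
  | base => rw [natBand_succ_self]; exact h s le_rfl (Nat.lt_succ_self s)
  | succ t hst ih =>
    rw [natBand_succ hst]
    have ht := h t (Nat.le_of_succ_le hst) (Nat.lt_succ_self t)
    exact (ht.mul_right (ih fun k h1 h2 => h k h1 (Nat.lt_succ_of_lt h2))).mul_right ht.inv_right

lemma commute_sigma_natBand_of_lt {k t s : ℕ} (hst : s < t) (h : t < k) :
    Commute (sigma n k) (natBand n t s) :=
  commute_natBand hst fun _ _ h2 => (sigma_comm (by omega)).symm

/-- Raising `t` conjugates by a generator that commutes with the lower band, so the base case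
propagates. -/
lemma natBand_eq_conj {t s r : ℕ} (hrs : r < s) (hst : s < t) :
    natBand n t r = natBand n t s * natBand n s r * (natBand n t s)⁻¹ := by
  induction t, hst using Nat.le_induction with
  | base => rw [natBand_succ hrs, natBand_succ_self]
  | succ t hst ih =>
    have hc := commute_sigma_natBand_of_lt (n := n) hrs hst
    rw [natBand_succ (hrs.trans hst), natBand_succ hst, ih]
    have h2 : (sigma n t)⁻¹ * natBand n s r * sigma n t = natBand n s r := by
      rw [mul_assoc, ← hc.eq, inv_mul_cancel_left]
    conv_lhs => rw [← h2]
    group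

/-- The first braid relation rewrites `b a b⁻¹` as `a⁻¹ b a`. Conjugation by `a` fixes `c`, so it
carries the braid relation of `b` and `c` to the claim. -/
lemma conj_braid {G : Type*} [Group G] {a b c : G} (hab : a * b * a = b * a * b)
    (hbc : b * c * b = c * b * c) (hac : Commute a c) :
    c * (b * a * b⁻¹) * c = (b * a * b⁻¹) * c * (b * a * b⁻¹) := by
  have h : b * a * b⁻¹ = a⁻¹ * b * a := by
    rw [mul_inv_eq_iff_eq_mul, mul_assoc, mul_assoc, eq_inv_mul_iff_mul_eq, ← mul_assoc,
      ← mul_assoc, hab]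
  have h1 : c * a⁻¹ = a⁻¹ * c := hac.inv_left.symm.eq
  have h2 : a * c = c * a := hac.eq
  rw [h]
  calc c * (a⁻¹ * b * a) * c = (c * a⁻¹) * b * (a * c) := by group
    _ = a⁻¹ * (c * b * c) * a := by rw [h1, h2]; group
    _ = a⁻¹ * (b * c * b) * a := by rw [hbc]
    _ = a⁻¹ * b * (a * c) * a⁻¹ * b * a := by rw [h2]; group
    _ = _ := by group

lemma natBand_braid_sigma {s r : ℕ} (hrs : r < s) (hs : s + 1 < n) :
    sigma n s * natBand n s r * sigma n s = natBand n s r * sigma n s * natBand n s r := by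
  induction s, hrs using Nat.le_induction with
  | base =>
    rw [natBand_succ_self]
    exact (sigma_braid hs).symm
  | succ s hrs ih =>
    rw [natBand_succ hrs]
    exact conj_braid (ih (by omega)).symm (sigma_braid hs)
      (commute_sigma_natBand_of_lt hrs (Nat.lt_succ_self s)).symm

lemma natBand_braid {t s r : ℕ} (hrs : r < s) (hst : s < t) (ht : t < n) :
    natBand n t s * natBand n s r * natBand n t s =
      natBand n s r * natBand n t s * natBand n s r := by
  induction t, hst using Nat.le_induction with
  | base =>
    rw [natBand_succ_self]
    exact natBand_braid_sigma hrs ht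
  | succ t hst ih =>
    have h2 : sigma n t * natBand n s r * (sigma n t)⁻¹ = natBand n s r := by
      rw [(commute_sigma_natBand_of_lt (n := n) hrs hst).eq, mul_inv_cancel_right]
    have h3 := congrArg (fun x => sigma n t * x * (sigma n t)⁻¹) (ih (by omega))
    rw [natBand_succ hst]
    conv_lhs => rw [← h2]
    conv_rhs => rw [← h2]
    simp only [mul_assoc, inv_mul_cancel_left] at h3 ⊢
    rw [h3]

/-- In the base case `t = k + 2` the band is the conjugate of `a_{ks}` by `σ_{k+1} σ_k`. That
element conjugates `σ_{k+1}`, which commutes with `a_{ks}`, to `σ_k`. -/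
lemma commute_sigma_natBand_of_nested {k t s : ℕ} (hsk : s < k) (hkt : k + 1 < t) (ht : t < n) :
    Commute (sigma n k) (natBand n t s) := by
  induction t, (show k + 2 ≤ t from hkt) using Nat.le_induction with
  | base =>
    rw [natBand_succ (by omega), natBand_succ hsk]
    have h1 : sigma n k * (sigma n (k + 1) * sigma n k) =
        sigma n (k + 1) * sigma n k * sigma n (k + 1) := by
      rw [← mul_assoc, sigma_braid ht]
    have h2 := (commute_sigma_natBand_of_lt (n := n) hsk (Nat.lt_succ_self k)).eq
    have h3 : SemiconjBy (sigma n (k + 1) * sigma n k) (sigma n (k + 1)) (sigma n k) := h1.symm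
    have h4 : Commute (sigma n (k + 1)) (natBand n k s) := h2
    have h5 := (h3.inv_symm_left).eq
    change sigma n k * _ = _ * sigma n k
    rw [show sigma n (k + 1) * (sigma n k * natBand n k s * (sigma n k)⁻¹) * (sigma n (k + 1))⁻¹ =
      (sigma n (k + 1) * sigma n k) * natBand n k s * (sigma n (k + 1) * sigma n k)⁻¹ by group,
      mul_assoc _ _ (sigma n k), h5, ← mul_assoc, ← mul_assoc, h1, mul_assoc _ (sigma n (k + 1)),
      h2]
    group
  | succ t hkt' ih =>
    rw [natBand_succ (by omega)]
    have h1 : Commute (sigma n k) (sigma n t) := sigma_comm (by omega)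
    exact (h1.mul_right (ih (by omega) (by omega))).mul_right h1.inv_right

variable {t s r q : Fin n}

/-- `a_{ts} a_{sr} = a_{tr} a_{ts}`. -/
lemma band_mul_band_right (hrs : r < s) (hst : s < t) :
    band t s * band s r = band t r * band t s := by
  simp only [band_eq_natBand]
  rw [natBand_eq_conj hrs hst, inv_mul_cancel_right]

/-- `a_{ts} a_{sr} = a_{sr} a_{tr}`. -/
lemma band_mul_band_left (hrs : r < s) (hst : s < t) :
    band t s * band s r = band s r * band t r := by
  simp only [band_eq_natBand]
  rw [natBand_eq_conj hrs hst, ← mul_assoc, ← mul_assoc, ← natBand_braid hrs hst t.2,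
    mul_inv_cancel_right]

lemma band_comm_of_separated (hst : s < t) (hqr : q < r) (h : r < s) :
    band t s * band r q = band r q * band t s := by
  simp only [band_eq_natBand]
  exact ((commute_natBand hst fun k h1 _ =>
    (commute_sigma_natBand_of_lt hqr (lt_of_lt_of_le h h1)).symm).symm).eq

lemma band_comm_of_nested (hqr : q < r) (hsq : s < q) (hrt : r < t) :
    band t s * band r q = band r q * band t s := by
  simp only [band_eq_natBand]
  exact (commute_natBand hqr fun k h1 h2 => (commute_sigma_natBand_of_nested
    (lt_of_lt_of_le hsq h1) (lt_of_le_of_lt (Nat.succ_le_of_lt h2) hrt) t.2).symm).eq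

lemma swap_mul_swap_eq {α : Type*} [DecidableEq α] (t s r q : α) :
    swap t s * swap r q = swap r q * swap (swap r q t) (swap r q s) := by
  rw [swap_apply_apply, swap_inv, mul_assoc, swap_mul_self_mul]

/-- Noncrossing band generators can be exchanged, compatibly with their transpositions. -/
lemma band_exchange (hst : s < t) (hqr : q < r) (hw : Window t s r ↔ Window t s q) :
    ∃ t' s' : Fin n, s' < t' ∧ swap t s * swap r q = swap r q * swap t' s' ∧
      band t s * band r q = band r q * band t' s' := by
  rw [swap_mul_swap_eq]
  by_cases h1 : t = r
  · subst h1
    have hsq : s < q := (hw.1 (window_left hst)).1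
    refine ⟨q, s, hsq, ?_, (band_mul_band_right hsq hqr).symm⟩
    rw [swap_apply_left, swap_apply_of_ne_of_ne hst.ne hsq.ne]
  by_cases h2 : s = q
  · subst h2
    have htr : t < r := by
      by_contra hle
      exact not_window_right (hw.1 ⟨hqr, not_lt.1 hle⟩)
    refine ⟨r, t, htr, ?_, ?_⟩
    · rw [swap_apply_right, swap_apply_of_ne_of_ne htr.ne hst.ne', swap_comm t r]
    · rw [← band_mul_band_left hst htr, band_mul_band_right hst htr]
  by_cases h3 : s = r
  · subst h3
    refine ⟨t, q, hqr.trans hst, ?_, band_mul_band_left hqr hst⟩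
    rw [swap_apply_left, swap_apply_of_ne_of_ne hst.ne' (hqr.trans hst).ne']
  -- The last possible shared endpoint is incompatible with the window condition; what remains are
  -- four disjoint positions in which the bands commute.
  have h4 : t ≠ q := by
    rintro rfl
    exact absurd (hw.2 (window_left hst)).2 (not_le.2 hqr)
  refine ⟨t, s, hst, ?_, ?_⟩
  · rw [swap_apply_of_ne_of_ne h1 h4, swap_apply_of_ne_of_ne h3 h2]
  simp only [Window, Fin.lt_def, Fin.le_def, Fin.ext_iff, ne_eq] at hw h1 h2 h3 h4 hst hqr
  rcases (by omega : r.1 < s.1 ∨ t.1 < q.1 ∨ (s.1 < q.1 ∧ r.1 < t.1) ∨ (q.1 < s.1 ∧ t.1 < r.1))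
    with h | h | ⟨h, h'⟩ | ⟨h, h'⟩
  · exact band_comm_of_separated hst hqr h
  · exact (band_comm_of_separated hqr hst h).symm
  · exact band_comm_of_nested hqr h h'
  · exact (band_comm_of_nested hst h h').symm

end BandRelations

end BandBraid
namespace BandBraid

open Equiv Equiv.Perm LengthFunction

/-! ### Lifting noncrossing permutations; the dual monoid inside the braid group. -/

section Lift

variable {n : ℕ}

/-- `BandFact w m`: the braid `m` is the product of a shortest word in band generators whose
transpositions multiply to `w`. -/
inductive BandFact : Perm (Fin n) → BraidGroup n → Prop
  | one : BandFact 1 1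
  | cons {t s : Fin n} {w : Perm (Fin n)} {m : BraidGroup n} (h : s < t)
      (hle : (permLength _).Le (swap t s) (swap t s * w)) (hw : BandFact w m) :
      BandFact (swap t s * w) (band t s * m)

lemma len_swap_mul {t s : Fin n} {w : Perm (Fin n)} (h : s < t)
    (hle : (permLength _).Le (swap t s) w) :
    (permLength _).len (swap t s * w) + 1 = (permLength _).len w := by
  unfold Le at hle
  rw [len_swap h.ne', swap_inv] at hle
  omega

lemma BandFact.cons' {t s : Fin n} {w : Perm (Fin n)} {m : BraidGroup n} (h : s < t)
    (hle : (permLength _).Le (swap t s) w) (hw : BandFact (swap t s * w) m) :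
    BandFact w (band t s * m) := by
  have := BandFact.cons h (by rwa [swap_mul_self_mul]) hw
  rwa [swap_mul_self_mul] at this

lemma exists_bandFact (w : Perm (Fin n)) : ∃ m, BandFact w m := by
  induction hk : (permLength _).len w using Nat.strong_induction_on generalizing w with
  | _ k ih =>
  by_cases hw : w = 1
  · exact ⟨1, hw ▸ BandFact.one⟩
  · obtain ⟨t, s, h, hle⟩ := exists_atom_le hw
    have := len_swap_mul h hle
    obtain ⟨m, hm⟩ := ih _ (by omega) (swap t s * w) rfl
    exact ⟨_, BandFact.cons' h hle hm⟩

lemma BandFact.exists_cons {w : Perm (Fin n)} {m : BraidGroup n} (h : BandFact w m) :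
    (w = 1 ∧ m = 1) ∨ ∃ t s m', s < t ∧ (permLength _).Le (swap t s) w ∧ m = band t s * m' ∧
      BandFact (swap t s * w) m' := by
  cases h with
  | one => exact Or.inl ⟨rfl, rfl⟩
  | @cons t s w m h hle hw =>
    exact Or.inr ⟨t, s, m, h, hle, rfl, by rwa [swap_mul_self_mul]⟩

/-- Induction on length, comparing first letters. If they are noncrossing, `band_exchange` completes
both to words with a common remainder `m₀`, and induction identifies each tail. If they cross, a
third word beginning with `(t r)` is noncrossing with both and mediates. -/
lemma BandFact.unique {w : Perm (Fin n)} (hw : (permLength _).Le w (descCycle n))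
    {m m' : BraidGroup n} (h : BandFact w m) (h' : BandFact w m') : m = m' := by
  induction hk : (permLength _).len w using Nat.strong_induction_on generalizing w m m' with
  | _ k ih =>
  have key : ∀ {t s r q : Fin n} {m₁ m₂ : BraidGroup n}, s < t → q < r →
      (permLength _).Le (swap t s) w → (permLength _).Le (swap r q) w →
      (Window t s r ↔ Window t s q) → BandFact (swap t s * w) m₁ → BandFact (swap r q * w) m₂ →
      band t s * m₁ = band r q * m₂ := by
    intro t s r q m₁ m₂ hst hqr hts hrq hwin h₁ h₂
    obtain ⟨t', s', hst', hsw, hband⟩ := band_exchange hst hqr hwin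
    have hle := swap_le_swap_mul hst hqr.ne' hw hts hwin hrq
    obtain ⟨m₀, hm₀⟩ := exists_bandFact (swap r q * (swap t s * w))
    have hl₁ := len_swap_mul hst hts
    have hl₂ := len_swap_mul hqr hrq
    have hl₃ := len_swap_mul hqr hle
    have hsw' : swap r q * (swap t s * w) = swap t' s' * (swap r q * w) := by
      have := congrArg (·⁻¹) hsw
      simp only [mul_inv_rev, swap_inv] at this
      rw [← mul_assoc, this, mul_assoc]
    have e₁ : m₁ = band r q * m₀ :=
      ih _ (by omega) (le_trans (swap_mul_le hts) hw) h₁ (BandFact.cons' hqr hle hm₀) rfl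
    have hle' : (permLength _).Le (swap t' s') (swap r q * w) := by
      unfold Le
      rw [len_swap hst'.ne', swap_inv, ← hsw']
      omega
    have e₂ : m₂ = band t' s' * m₀ :=
      ih _ (by omega) (le_trans (swap_mul_le hrq) hw) h₂
        (BandFact.cons' hst' hle' (hsw' ▸ hm₀)) rfl
    rw [e₁, e₂, ← mul_assoc, hband, mul_assoc]
  have cross : ∀ {t r s q : Fin n} {m₁ m₂ : BraidGroup n}, r < t → s < r → q < s →
      (permLength _).Le (swap t s) w → (permLength _).Le (swap r q) w →
      BandFact (swap t s * w) m₁ → BandFact (swap r q * w) m₂ →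
      band t s * m₁ = band r q * m₂ := by
    intro t r s q m₁ m₂ hrt hsr hqs hts hrq h₁ h₂
    have htr := (swap_le_iff hrt.ne').2 (sameCycle_of_crossing hrt hsr hqs hw hts hrq).1
    obtain ⟨m₃, hm₃⟩ := exists_bandFact (swap t r * w)
    refine (key (hsr.trans hrt) hrt hts htr ?_ h₁ hm₃).trans
      (key hrt (hqs.trans hsr) htr hrq ?_ hm₃ h₂) <;>
    · simp only [Window, Fin.lt_def, Fin.le_def] at *
      omega
  rcases h.exists_cons with ⟨rfl, rfl⟩ | ⟨t, s, m₁, hst, hts, rfl, h₁⟩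
  · rcases h'.exists_cons with ⟨-, rfl⟩ | ⟨t, s, m₁, hst, hts, rfl, -⟩
    · rfl
    · rw [le_one_iff, swap_eq_one_iff] at hts
      exact absurd hts hst.ne'
  rcases h'.exists_cons with ⟨rfl, rfl⟩ | ⟨r, q, m₂, hqr, hrq, rfl, h₂⟩
  · rw [le_one_iff, swap_eq_one_iff] at hts
    exact absurd hts hst.ne'
  rcases window_trichotomy hst hqr with ⟨rfl, rfl⟩ | hwin | hwin | ⟨a, b, d⟩ | ⟨a, b, d⟩
  · have hl₁ := len_swap_mul hst hts
    rw [ih _ (by omega) (le_trans (swap_mul_le hts) hw) h₁ h₂ rfl]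
  · exact key hst hqr hts hrq hwin h₁ h₂
  · exact (key hqr hst hrq hts hwin h₂ h₁).symm
  · exact cross a b d hts hrq h₁ h₂
  · exact (cross a b d hrq hts h₂ h₁).symm

lemma BandFact.mul {u v : Perm (Fin n)} {m m' : BraidGroup n} (h : BandFact u m)
    (h' : BandFact v m') (hle : (permLength _).Le u (u * v)) : BandFact (u * v) (m * m') := by
  induction h with
  | one => simpa using h'
  | @cons t s w m hst hts hw ih =>
    rw [mul_assoc] at hle ⊢
    rw [mul_assoc]
    rw [le_mul_iff] at hts
    have h1 := (permLength _).len_mul_le (swap t s) (w * v)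
    have h2 := (permLength _).len_mul_le w v
    rw [← mul_assoc, le_mul_iff, mul_assoc] at hle
    refine BandFact.cons hst ?_ (ih ?_) <;> rw [le_mul_iff] <;> omega

lemma BandFact.mem_positiveBraids {w : Perm (Fin n)} {m : BraidGroup n} (h : BandFact w m) :
    m ∈ positiveBraids n := by
  induction h with
  | one => exact one_mem _
  | cons hst _ _ ih => exact mul_mem (Submonoid.subset_closure ⟨_, _, hst, rfl⟩) ih

/-- The simple elements attached to `descCycle n`, which model noncrossing partitions. -/
abbrev NCPerm (n : ℕ) : Type := (permLength (Fin n)).Simple (descCycle n)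

/-- The dual braid monoid. -/
abbrev DualMonoid (n : ℕ) : Type := (permLength (Fin n)).IntervalMonoid (descCycle n)

/-- The lift of a noncrossing permutation to the braid group. -/
noncomputable def bandLift (u : NCPerm n) : BraidGroup n := (exists_bandFact u.1).choose

lemma bandFact_bandLift (u : NCPerm n) : BandFact u.1 (bandLift u) :=
  (exists_bandFact u.1).choose_spec

lemma BandFact.eq_bandLift {u : NCPerm n} {m : BraidGroup n} (h : BandFact u.1 m) :
    m = bandLift u :=
  h.unique u.2 (bandFact_bandLift u)

/-- The homomorphism from the dual braid monoid to the braid group. -/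
noncomputable def toBraid : DualMonoid n →* BraidGroup n :=
  liftGerm bandLift
    (fun u hu => (BandFact.eq_bandLift (hu ▸ BandFact.one)).symm)
    (fun u v w h hl => BandFact.eq_bandLift (by
      rw [← h] at hl ⊢
      exact (bandFact_bandLift u).mul (bandFact_bandLift v) hl))

@[simp] lemma toBraid_gen (u : NCPerm n) : toBraid (gen u) = bandLift u := rfl

/-- A transposition as a noncrossing permutation. -/
def atom (t s : Fin n) (h : s < t) : NCPerm n := ⟨swap t s, swap_le_descCycle h.ne'⟩

lemma toBraid_atom {t s : Fin n} (h : s < t) : toBraid (gen (atom t s h)) = band t s := by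
  refine (BandFact.eq_bandLift ?_).symm
  have := BandFact.cons' (w := swap t s) h (LengthFunction.le_refl _)
    (by rw [swap_mul_self]; exact BandFact.one)
  rwa [mul_one] at this

lemma toBraid_mem (P : DualMonoid n) : toBraid P ∈ positiveBraids n := by
  induction P using IntervalMonoid.induction with
  | h1 => rw [map_one]; exact one_mem _
  | hmul u P ih =>
    rw [map_mul]
    exact mul_mem (bandFact_bandLift u).mem_positiveBraids ih

lemma exists_toBraid_eq {P : BraidGroup n} (hP : P ∈ positiveBraids n) :
    ∃ p : DualMonoid n, toBraid p = P := by
  induction hP using Submonoid.closure_induction with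
  | mem x hx =>
    obtain ⟨t, s, h, rfl⟩ := hx
    exact ⟨_, toBraid_atom h⟩
  | one => exact ⟨1, map_one _⟩
  | mul x y _ _ hx hy =>
    obtain ⟨p, rfl⟩ := hx
    obtain ⟨q, rfl⟩ := hy
    exact ⟨p * q, map_mul _ _ _⟩

/-- Both sides are geodesic factorizations of one simple element, so both equal its generator. -/
lemma gen_atom_mul_gen_atom {t s r q t' s' r' q' : Fin n} (hst : s < t) (hqr : q < r)
    (hst' : s' < t') (hqr' : q' < r') (hw : Window t s r ↔ Window t s q)
    (hw' : Window t' s' r' ↔ Window t' s' q')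
    (h : swap t s * swap r q = swap t' s' * swap r' q') :
    (gen (atom t s hst) * gen (atom r q hqr) : DualMonoid n) =
      gen (atom t' s' hst') * gen (atom r' q' hqr') := by
  obtain ⟨h1, h2, -⟩ := isJoin_of_window hst hqr.ne' hw
  obtain ⟨-, h2', -⟩ := isJoin_of_window hst' hqr'.ne' hw'
  let w : NCPerm n := ⟨swap t s * swap r q, h1⟩
  rw [← h] at h2'
  exact (gen_mul_gen (u := atom t s hst) (v := atom r q hqr) (w := w) rfl h2).trans
    (gen_mul_gen (u := atom t' s' hst') (v := atom r' q' hqr') (w := w) h.symm h2').symm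

lemma gen_atom_mul_right {t s r : Fin n} (hrs : r < s) (hst : s < t) :
    (gen (atom t s hst) * gen (atom s r hrs) : DualMonoid n) =
      gen (atom t r (hrs.trans hst)) * gen (atom t s hst) := by
  refine gen_atom_mul_gen_atom _ _ _ _ ?_ ?_ ?_
  · simp only [Window, Fin.lt_def, Fin.le_def] at *; omega
  · simp only [Window, Fin.lt_def, Fin.le_def] at *; omega
  · rw [swap_mul_swap_eq t r t s, swap_apply_left,
      swap_apply_of_ne_of_ne (hrs.trans hst).ne hrs.ne]

lemma gen_atom_mul_left {t s r : Fin n} (hrs : r < s) (hst : s < t) :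
    (gen (atom t s hst) * gen (atom s r hrs) : DualMonoid n) =
      gen (atom s r hrs) * gen (atom t r (hrs.trans hst)) := by
  refine gen_atom_mul_gen_atom _ _ _ _ ?_ ?_ ?_
  · simp only [Window, Fin.lt_def, Fin.le_def] at *; omega
  · simp only [Window, Fin.lt_def, Fin.le_def] at *; omega
  · rw [swap_mul_swap_eq t s s r, swap_apply_left,
      swap_apply_of_ne_of_ne hst.ne' (hrs.trans hst).ne']

/-- With `a_{tr}` as intermediary: `a_{ts} a_{sr} a_{ts} = a_{sr} a_{tr} a_{ts} = a_{sr} a_{ts}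
a_{sr}`. -/
lemma gen_atom_braid {t s r : Fin n} (hrs : r < s) (hst : s < t) :
    (gen (atom t s hst) * gen (atom s r hrs) * gen (atom t s hst) : DualMonoid n) =
      gen (atom s r hrs) * gen (atom t s hst) * gen (atom s r hrs) := by
  conv_lhs => rw [gen_atom_mul_left hrs hst, mul_assoc, ← gen_atom_mul_right hrs hst, ← mul_assoc]

/-- The transposition of `k` and `k + 1` as a noncrossing permutation. -/
def simpleAtom (k : Fin (n - 1)) : NCPerm n :=
  atom ⟨k + 1, by omega⟩ ⟨k, by omega⟩ (by simp [Fin.lt_def])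

lemma simpleAtom_comm {k l : Fin (n - 1)} (h : 1 < |(k : ℤ) - (l : ℤ)|) :
    (gen (simpleAtom k) * gen (simpleAtom l) : DualMonoid n) =
      gen (simpleAtom l) * gen (simpleAtom k) := by
  rw [lt_abs] at h
  refine gen_atom_mul_gen_atom _ _ _ _ ?_ ?_ ?_
  · simp only [Window, Fin.lt_def, Fin.le_def]; omega
  · simp only [Window, Fin.lt_def, Fin.le_def]; omega
  · rw [swap_mul_swap_eq, swap_apply_of_ne_of_ne, swap_apply_of_ne_of_ne] <;>
    · simp only [Ne, Fin.ext_iff]; omega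

lemma simpleAtom_braid {k l : Fin (n - 1)} (h : |(k : ℤ) - (l : ℤ)| = 1) :
    (gen (simpleAtom k) * gen (simpleAtom l) * gen (simpleAtom k) : DualMonoid n) =
      gen (simpleAtom l) * gen (simpleAtom k) * gen (simpleAtom l) := by
  wlog hkl : l < k generalizing k l
  · exact (this (by rwa [abs_sub_comm]) (by
      rcases lt_trichotomy k l with h1 | rfl | h1
      · exact h1
      · simp at h
      · exact absurd h1 hkl)).symm
  have hk : k.1 = l.1 + 1 := by
    rw [abs_eq one_pos.le] at h
    rw [Fin.lt_def] at hkl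
    omega
  obtain ⟨k, hk'⟩ := k
  obtain ⟨l, hl'⟩ := l
  obtain rfl : k = l + 1 := hk
  exact gen_atom_braid (t := ⟨l + 1 + 1, by omega⟩) (s := ⟨l + 1, by omega⟩)
    (r := ⟨l, by omega⟩) _ _

/-- The monoid embeds by `f` into a group where the images of the adjacent transpositions satisfy
the Artin relations. The induced map `ψ` on the braid group composes with `toBraid` to give `f`. -/
theorem toBraid_injective : Function.Injective (toBraid : DualMonoid n → BraidGroup n) := by
  obtain ⟨G, _, f, hf⟩ := exists_injective_hom_group (L := permLength (Fin n)) (c := descCycle n)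
    (pow_orderOf_eq_one _) (orderOf_pos _).ne'
  have hrel : ∀ r ∈ artinRels n,
      FreeGroup.lift (fun k : Fin (n - 1) => f (gen (simpleAtom k))) r = 1 := by
    rintro _ (⟨k, l, h, rfl⟩ | ⟨k, l, h, rfl⟩)
    · rw [map_mul, map_inv, mul_inv_eq_one]
      simp only [map_mul, FreeGroup.lift_apply_of]
      rw [← map_mul, ← map_mul, simpleAtom_comm h]
    · rw [map_mul, map_inv, mul_inv_eq_one]
      simp only [map_mul, FreeGroup.lift_apply_of]
      rw [← map_mul, ← map_mul, ← map_mul, ← map_mul, simpleAtom_braid h]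
  let ψ : BraidGroup n →* G := PresentedGroup.toGroup hrel
  have hσ : ∀ k (hk : k < n - 1), ψ (sigma n k) = f (gen (simpleAtom ⟨k, hk⟩)) := by
    intro k hk
    simp only [sigma, dif_pos hk, ψ]
    exact PresentedGroup.toGroup.of hrel
  -- Bands are conjugates in the braid group but atoms in the monoid; `gen_atom_mul_right` expresses
  -- each atom as the matching conjugate.
  have hband : ∀ t s (hst : s < t) (ht : t < n), ψ (natBand n t s) =
      f (gen (atom ⟨t, ht⟩ ⟨s, hst.trans ht⟩ hst)) := by
    intro t s hst
    induction t, hst using Nat.le_induction with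
    | base =>
      intro ht
      rw [natBand_succ_self, hσ s (by omega)]
      rfl
    | succ t hst ih =>
      intro ht
      rw [natBand_succ hst, map_mul, map_mul, map_inv, hσ t (by omega), ih (by omega),
        mul_inv_eq_iff_eq_mul, ← map_mul, ← map_mul]
      exact congrArg f (gen_atom_mul_right (t := ⟨t + 1, ht⟩) (s := ⟨t, by omega⟩)
        (r := ⟨s, by omega⟩) hst (Nat.lt_succ_self t))
  have hfact : ∀ {w : Perm (Fin n)} {m : BraidGroup n}, BandFact w m →
      ∀ hw : (permLength _).Le w (descCycle n), ψ m = f (gen ⟨w, hw⟩) := by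
    intro w m h
    induction h with
    | one => intro hw; rw [map_one, gen_eq_one rfl, map_one]
    | @cons t s w m hst hle _ ih =>
      intro hw
      have hw' := le_trans (le_of_geodesic_right hle) hw
      rw [map_mul, ih hw', band_eq_natBand, hband t s hst t.2, ← map_mul]
      exact congrArg f (gen_mul_gen rfl hle)
  have hψ : ∀ P : DualMonoid n, ψ (toBraid P) = f P := by
    intro P
    induction P using IntervalMonoid.induction with
    | h1 => simp
    | hmul u P ih => rw [map_mul, map_mul, ih, map_mul, toBraid_gen,
        hfact (bandFact_bandLift u) u.2]
  intro P Q h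
  apply hf
  rw [← hψ, ← hψ, h]

end Lift

end BandBraid
namespace BandBraid

open Equiv Equiv.Perm LengthFunction

/-! ### Starting sets, canonical factors and parallel cycles. -/

section CanonicalFactors

variable {n : ℕ}

lemma braidLE_one_iff {P : BraidGroup n} : BraidLE 1 P ↔ P ∈ positiveBraids n := by
  constructor
  · rintro ⟨P₁, h₁, P₂, h₂, rfl⟩
    rw [mul_one]
    exact mul_mem h₁ h₂
  · exact fun h => ⟨P, h, 1, one_mem _, by simp⟩

/-- The band generators whose transpositions lie below `w`. -/
def bandsBelow (w : Perm (Fin n)) : Set (BraidGroup n) :=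
  {a | ∃ t s : Fin n, s < t ∧ (permLength _).Le (swap t s) w ∧ a = band t s}

/-- Injectivity turns division with a positive quotient into division in the dual monoid, which the
head controls. -/
lemma startingSet_toBraid (p : DualMonoid n) :
    startingSet (toBraid p) = bandsBelow p.head.1 := by
  ext a
  constructor
  · rintro ⟨⟨t, s, h, rfl⟩, P', hP', e⟩
    obtain ⟨p', rfl⟩ := exists_toBraid_eq (braidLE_one_iff.1 hP')
    rw [← toBraid_atom h, ← map_mul] at e
    exact ⟨t, s, h, exists_eq_gen_mul_iff.1 ⟨p', toBraid_injective e⟩, rfl⟩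
  · rintro ⟨t, s, h, hle, rfl⟩
    obtain ⟨q, hq⟩ := exists_eq_gen_mul_iff (u := atom t s h).2 hle
    refine ⟨⟨t, s, h, rfl⟩, toBraid q, braidLE_one_iff.2 (toBraid_mem q), ?_⟩
    rw [← toBraid_atom h, ← map_mul, ← hq]

lemma startingSet_bandLift (w : NCPerm n) : startingSet (bandLift w) = bandsBelow w.1 := by
  rw [← toBraid_gen, startingSet_toBraid, head_gen]

/-- Right divisors of a simple element are its suffixes, and conjugation invariance of length makes
suffixes and prefixes the same. -/
lemma finishingSet_bandLift (w : NCPerm n) : finishingSet (bandLift w) = bandsBelow w.1 := by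
  rw [← toBraid_gen]
  ext a
  constructor
  · rintro ⟨⟨t, s, h, rfl⟩, P', hP', e⟩
    obtain ⟨p', rfl⟩ := exists_toBraid_eq (braidLE_one_iff.1 hP')
    rw [← toBraid_atom h, ← map_mul] at e
    obtain ⟨u, v, -, hv, huv, hle⟩ := exists_gen_of_mul_eq_gen (toBraid_injective e).symm
    obtain rfl := gen_injective hv
    refine ⟨t, s, h, ?_, rfl⟩
    rw [← huv] at hle ⊢
    exact le_of_geodesic_right hle
  · rintro ⟨t, s, h, hle, rfl⟩
    have hle' : (permLength _).Le (w.1 * (swap t s)⁻¹) w.1 := by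
      have e : w.1 = (w.1 * (swap t s)⁻¹) * swap t s := by group
      rw [e, le_mul_left_iff, ← le_mul_iff, ← e] at hle
      exact hle
    let u : NCPerm n := ⟨w.1 * (swap t s)⁻¹, le_trans hle' w.2⟩
    have hu : gen u * gen (atom t s h) = gen w :=
      gen_mul_gen (inv_mul_cancel_right _ _) hle'
    refine ⟨⟨t, s, h, rfl⟩, toBraid (gen u), braidLE_one_iff.2 (toBraid_mem _), ?_⟩
    rw [← toBraid_atom h, ← map_mul, hu]

lemma band_mem_bandsBelow_iff {t s : Fin n} (h : s < t) {w : Perm (Fin n)} :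
    band t s ∈ bandsBelow w ↔ (permLength _).Le (swap t s) w := by
  refine ⟨?_, fun hle => ⟨t, s, h, hle, rfl⟩⟩
  rintro ⟨t', s', h', hle, e⟩
  rw [← toBraid_atom h, ← toBraid_atom h'] at e
  have := congrArg Subtype.val (gen_injective (toBraid_injective e))
  change swap t s = swap t' s' at this
  rwa [this]

lemma bandsBelow_subset_iff {u v : NCPerm n} :
    bandsBelow u.1 ⊆ bandsBelow v.1 ↔ (permLength _).Le u.1 v.1 := by
  constructor
  · intro h
    refine le_of_swap_le u.2 v.2 fun t s hst hle => ?_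
    exact (band_mem_bandsBelow_iff hst).1 (h ⟨t, s, hst, hle, rfl⟩)
  · rintro h _ ⟨t, s, hst, hle, rfl⟩
    exact ⟨t, s, hst, le_trans hle h, rfl⟩

lemma bandsBelow_injective {u v : NCPerm n} (h : bandsBelow u.1 = bandsBelow v.1) : u = v :=
  Subtype.ext (le_antisymm (bandsBelow_subset_iff.1 h.le) (bandsBelow_subset_iff.1 h.ge))

lemma mem_of_sameCycle_formPerm {l : List (Fin n)} {i j : Fin n} (hij : i ≠ j)
    (h : l.formPerm.SameCycle i j) : i ∈ l := by
  by_contra hi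
  exact hij (h.eq_of_left (List.formPerm_apply_of_notMem hi))

/-- Peel off the largest subscript: the others are at most `s`, hence outside the window of `(t s)`,
so the shorter cycle lies below the complement of `(t s)`. -/
lemma chain_spec {l : List (Fin n)} (hl : l.Pairwise (fun t s => s < t)) :
    (permLength _).Le l.formPerm (descCycle n) ∧ BandFact l.formPerm (chain l) := by
  induction l with
  | nil => exact ⟨one_le _, BandFact.one⟩
  | cons t l ih =>
    cases l with
    | nil => exact ⟨one_le _, BandFact.one⟩
    | cons s l =>
      obtain ⟨ih₁, ih₂⟩ := ih hl.of_cons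
      have hst : s < t := List.rel_of_pairwise_cons hl (by simp)
      have hmem : ∀ i ∈ s :: l, ¬ Window t s i := by
        intro i hi hw
        rcases List.mem_cons.1 hi with rfl | hi
        · exact not_window_right hw
        · exact lt_asymm hw.1 (List.rel_of_pairwise_cons hl.of_cons hi)
      have hts := swap_le_descCycle hst.ne'
      have hle : (permLength _).Le (s :: l).formPerm ((swap t s)⁻¹ * descCycle n) := by
        rw [swap_inv]
        refine le_of_swap_le ih₁ (swap_mul_le hts) fun r q hqr hrq => ?_
        rw [swap_le_swap_mul_descCycle_iff hst hqr.ne']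
        have hc := (swap_le_iff hqr.ne').1 hrq
        exact iff_of_false (hmem r (mem_of_sameCycle_formPerm hqr.ne' hc))
          (hmem q (mem_of_sameCycle_formPerm hqr.ne hc.symm))
      obtain ⟨h₁, h₂⟩ := mul_le_of_le_inv_mul hts hle
      rw [List.formPerm_cons_cons]
      exact ⟨h₂, BandFact.cons hst h₁ ih₂⟩

lemma pairwise_gt_reverse_finRange : (List.finRange n).reverse.Pairwise (fun t s => s < t) := by
  rw [List.pairwise_reverse]
  exact List.pairwise_lt_finRange n

lemma delta_eq : delta n = toBraid (top (permLength (Fin n)) (descCycle n)) :=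
  BandFact.eq_bandLift (u := ⟨descCycle n, _⟩) (chain_spec pairwise_gt_reverse_finRange).2

/-- `delta n` is the image of the top generator, and factors of a generator are generators by
`exists_gen_of_mul_eq_gen`. -/
lemma isCanonicalFactor_iff {A : BraidGroup n} :
    IsCanonicalFactor A ↔ ∃ w : NCPerm n, A = bandLift w := by
  constructor
  · rintro ⟨h₁, P₁, hP₁, P₂, hP₂, e⟩
    obtain ⟨a, rfl⟩ := exists_toBraid_eq (braidLE_one_iff.1 h₁)
    obtain ⟨p₁, rfl⟩ := exists_toBraid_eq hP₁
    obtain ⟨p₂, rfl⟩ := exists_toBraid_eq hP₂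
    rw [delta_eq, ← map_mul, ← map_mul] at e
    obtain ⟨u, -, hu, -⟩ := exists_gen_of_mul_eq_gen (toBraid_injective e).symm
    obtain ⟨-, v, -, hv, -⟩ := exists_gen_of_mul_eq_gen hu
    exact ⟨v, by rw [hv, toBraid_gen]⟩
  · rintro ⟨w, rfl⟩
    refine ⟨braidLE_one_iff.2 (toBraid_mem (gen w)), 1, one_mem _, toBraid (gen w.compl),
      toBraid_mem _, ?_⟩
    rw [delta_eq, one_mul, ← toBraid_gen, ← map_mul, gen_mul_gen_compl]

namespace DescendingCycle

/-- The permutation of a descending cycle. -/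
def perm (π : DescendingCycle n) : Perm (Fin n) := π.subscripts.formPerm

lemma nodup (π : DescendingCycle n) : π.subscripts.Nodup :=
  π.descending.imp fun h => h.ne'

lemma perm_le (π : DescendingCycle n) : (permLength _).Le π.perm (descCycle n) :=
  (chain_spec π.descending).1

lemma bandFact_braid (π : DescendingCycle n) : BandFact π.perm π.braid :=
  (chain_spec π.descending).2

lemma sameCycle_perm_iff (π : DescendingCycle n) {i j : Fin n} (hij : i ≠ j) :
    π.perm.SameCycle i j ↔ i ∈ π.subscripts ∧ j ∈ π.subscripts :=
  ⟨fun h => ⟨mem_of_sameCycle_formPerm hij h, mem_of_sameCycle_formPerm hij.symm h.symm⟩,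
    fun h => sameCycle_formPerm π.nodup π.two_le_length h.1 h.2⟩

lemma braid_eq (π : DescendingCycle n) : π.braid = bandLift ⟨π.perm, π.perm_le⟩ :=
  BandFact.eq_bandLift (u := ⟨π.perm, π.perm_le⟩) π.bandFact_braid

lemma bandsBelow_perm (π : DescendingCycle n) : bandsBelow π.perm =
    {a | ∃ t ∈ π.subscripts, ∃ s ∈ π.subscripts, s < t ∧ a = band t s} := by
  ext a
  constructor
  · rintro ⟨t, s, h, hle, rfl⟩
    obtain ⟨ht, hs⟩ := (π.sameCycle_perm_iff h.ne').1 ((swap_le_iff h.ne').1 hle)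
    exact ⟨t, ht, s, hs, h, rfl⟩
  · rintro ⟨t, ht, s, hs, h, rfl⟩
    exact ⟨t, s, h, (swap_le_iff h.ne').2 ((π.sameCycle_perm_iff h.ne').2 ⟨ht, hs⟩), rfl⟩

lemma exists_ne_mem (π : DescendingCycle n) (i : Fin n) : ∃ j ∈ π.subscripts, j ≠ i := by
  by_contra! h
  have h1 := List.eq_replicate_of_mem h
  have h2 := π.nodup
  rw [h1, List.nodup_replicate] at h2
  have := π.two_le_length
  omega

/-- Positivity says that `t` and `s` are both strictly between `q` and `r` or both strictly outside;
no equality occurs, so the half-open ends of the window are harmless. -/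
lemma Parallel.window_iff {π μ : DescendingCycle n} (h : π.Parallel μ) {t s r q : Fin n}
    (ht : t ∈ π.subscripts) (hs : s ∈ π.subscripts) (hr : r ∈ μ.subscripts)
    (hq : q ∈ μ.subscripts) (hst : s < t) (hqr : q < r) : Window r q t ↔ Window r q s := by
  have := h t ht s hs r hr q hq hst hqr
  simp only [Window, Fin.lt_def, Fin.le_def] at *
  rw [mul_assoc] at this
  rcases mul_pos_iff.1 this with ⟨h1, h2⟩ | ⟨h1, h2⟩
  · rcases mul_pos_iff.1 h1 with h1 | h1 <;> rcases mul_pos_iff.1 h2 with h2 | h2 <;> omega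
  · rcases mul_neg_iff.1 h1 with h1 | h1 <;> rcases mul_neg_iff.1 h2 with h2 | h2 <;> omega

/-- Each cycle has a second entry, so a common entry would produce a zero factor in the parallelism
product. -/
lemma Parallel.disjoint {π μ : DescendingCycle n} (h : π.Parallel μ) {i : Fin n}
    (hi : i ∈ π.subscripts) : i ∉ μ.subscripts := by
  intro hi'
  obtain ⟨j, hj, hji⟩ := π.exists_ne_mem i
  obtain ⟨k, hk, hki⟩ := μ.exists_ne_mem i
  rcases lt_or_gt_of_ne hji with h1 | h1 <;> rcases lt_or_gt_of_ne hki with h2 | h2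
  · simpa using h i hi j hj i hi' k hk h1 h2
  · simpa using h i hi j hj k hk i hi' h1 h2
  · simpa using h j hj i hi i hi' k hk h1 h2
  · simpa using h j hj i hi k hk i hi' h1 h2

end DescendingCycle

lemma sameCycle_mul_of_disjoint {u v : Perm (Fin n)} (h : u.Disjoint v) {i j : Fin n}
    (hij : (u * v).SameCycle i j) : u.SameCycle i j ∨ v.SameCycle i j := by
  obtain ⟨k, rfl⟩ := hij
  rcases h i with hi | hi
  · right
    rw [h.commute.eq, h.commute.symm.mul_zpow, mul_apply, zpow_apply_eq_self_of_apply_eq_self hi]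
    exact ⟨k, rfl⟩
  · left
    rw [h.commute.mul_zpow, mul_apply, zpow_apply_eq_self_of_apply_eq_self hi]
    exact ⟨k, rfl⟩

/-- Parallel cycles are disjoint, so multiplying them only collects their cycles; the noncrossing
condition keeps the product below the n-cycle and geodesic. -/
lemma exists_bandFact_prod_of_parallel (L : List (DescendingCycle n))
    (hL : L.Pairwise DescendingCycle.Parallel) :
    ∃ w : Perm (Fin n), (permLength _).Le w (descCycle n) ∧
      BandFact w (L.map DescendingCycle.braid).prod ∧
      ∀ i j, i ≠ j →
        (w.SameCycle i j ↔ ∃ π ∈ L, i ∈ π.subscripts ∧ j ∈ π.subscripts) := by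
  induction L with
  | nil =>
    refine ⟨1, one_le _, BandFact.one, fun i j hij => ?_⟩
    simpa using hij
  | cons π L ih =>
    obtain ⟨v, hv, hvf, hvc⟩ := ih hL.of_cons
    have hpar : ∀ μ ∈ L, π.Parallel μ := fun μ hμ => List.rel_of_pairwise_cons hL hμ
    have hfix : ∀ i ∈ π.subscripts, v i = i := by
      intro i hi
      by_contra hne
      obtain ⟨μ, hμ, hiμ, -⟩ := (hvc i (v i) (Ne.symm hne)).1 ⟨1, by simp⟩
      exact (hpar μ hμ).disjoint hi hiμ
    have hdisj : π.perm.Disjoint v := by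
      intro i
      by_cases hi : i ∈ π.subscripts
      · exact Or.inr (hfix i hi)
      · exact Or.inl (List.formPerm_apply_of_notMem hi)
    -- It suffices to test a transposition `(r q)` below `v`. Its window does not separate the
    -- points of `π`, so `π.perm` fits below its complement; `(r q)` commutes with `π.perm`, so the
    -- roles can be exchanged.
    have hle : (permLength _).Le v (π.perm⁻¹ * descCycle n) := by
      refine le_of_swap_le hv (inv_mul_le π.perm_le) fun r q hqr hrq => ?_
      obtain ⟨μ, hμ, hr, hq⟩ := (hvc r q hqr.ne').1 ((swap_le_iff hqr.ne').1 hrq)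
      have hrq' := swap_le_descCycle hqr.ne'
      have h1 : (permLength _).Le π.perm ((swap r q)⁻¹ * descCycle n) := by
        rw [swap_inv]
        refine le_of_swap_le π.perm_le (swap_mul_le hrq') fun t s hst hts => ?_
        obtain ⟨ht, hs⟩ := (π.sameCycle_perm_iff hst.ne').1 ((swap_le_iff hst.ne').1 hts)
        rw [swap_le_swap_mul_descCycle_iff hqr hst.ne']
        exact (hpar μ hμ).window_iff ht hs hr hq hst hqr
      obtain ⟨h2, h3⟩ := mul_le_of_le_inv_mul hrq' h1
      have hfixμ : ∀ i ∈ μ.subscripts, π.perm i = i := fun i hi =>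
        List.formPerm_apply_of_notMem fun hi' => (hpar μ hμ).disjoint hi' hi
      have hcomm : swap r q * π.perm = π.perm * swap r q := by
        rw [mul_swap_eq_swap_mul, hfixμ r hr, hfixμ q hq]
      rw [hcomm] at h3
      refine le_inv_mul_of_mul_le ?_ h3
      have h4 := le_of_geodesic_right h2
      rwa [hcomm] at h4
    obtain ⟨h1, h2⟩ := mul_le_of_le_inv_mul π.perm_le hle
    refine ⟨π.perm * v, h2, ?_, fun i j hij => ?_⟩
    · rw [List.map_cons, List.prod_cons]
      exact π.bandFact_braid.mul hvf h1
    · simp only [List.mem_cons, exists_eq_or_imp]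
      rw [← π.sameCycle_perm_iff hij, ← hvc i j hij]
      exact ⟨sameCycle_mul_of_disjoint hdisj,
        fun h => h.elim (sameCycle_of_le h1) (sameCycle_of_le (le_of_geodesic_right h1))⟩

lemma startingSet_prod_of_parallel (L : List (DescendingCycle n))
    (hL : L.Pairwise DescendingCycle.Parallel) :
    startingSet (L.map DescendingCycle.braid).prod = ⋃ π ∈ L, startingSet π.braid := by
  obtain ⟨w, hw, hf, hc⟩ := exists_bandFact_prod_of_parallel L hL
  rw [BandFact.eq_bandLift (u := ⟨w, hw⟩) hf, startingSet_bandLift]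
  ext a
  simp only [Set.mem_iUnion, exists_prop]
  constructor
  · rintro ⟨t, s, h, hle, rfl⟩
    obtain ⟨π, hπ, ht, hs⟩ := (hc t s h.ne').1 ((swap_le_iff h.ne').1 hle)
    refine ⟨π, hπ, ?_⟩
    rw [π.braid_eq, startingSet_bandLift, π.bandsBelow_perm]
    exact ⟨t, ht, s, hs, h, rfl⟩
  · rintro ⟨π, hπ, ha⟩
    rw [π.braid_eq, startingSet_bandLift, π.bandsBelow_perm] at ha
    obtain ⟨t, ht, s, hs, h, rfl⟩ := ha
    exact ⟨t, s, h, (swap_le_iff h.ne').2 ((hc t s h.ne').2 ⟨π, hπ, ht, hs⟩), rfl⟩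

end CanonicalFactors

end BandBraid

theorem mainTheorem10 (n : ℕ) :
    -- (I)
    (∀ π : BandBraid.DescendingCycle n,
      BandBraid.startingSet π.braid =
          {a | ∃ t ∈ π.subscripts, ∃ s ∈ π.subscripts, s < t ∧ a = BandBraid.band t s} ∧
      BandBraid.finishingSet π.braid =
          {a | ∃ t ∈ π.subscripts, ∃ s ∈ π.subscripts, s < t ∧ a = BandBraid.band t s}) ∧
    -- (II)
    (∀ L : List (BandBraid.DescendingCycle n),
      L.Pairwise BandBraid.DescendingCycle.Parallel →
      BandBraid.startingSet (L.map BandBraid.DescendingCycle.braid).prod =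
        ⋃ π ∈ L, BandBraid.startingSet π.braid) ∧
    -- (III)
    (∀ A : BandBraid.BraidGroup n, BandBraid.IsCanonicalFactor A →
      BandBraid.startingSet A = BandBraid.finishingSet A) ∧
    -- (IV)
    (∀ A B : BandBraid.BraidGroup n,
      BandBraid.IsCanonicalFactor A → BandBraid.IsCanonicalFactor B →
      BandBraid.startingSet A = BandBraid.startingSet B → A = B) ∧
    -- (V)
    (∀ P : BandBraid.BraidGroup n, P ∈ BandBraid.positiveBraids n →
      ∃ A : BandBraid.BraidGroup n, BandBraid.IsCanonicalFactor A ∧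
        BandBraid.startingSet P = BandBraid.startingSet A) ∧
    -- (VI)
    (∀ A P : BandBraid.BraidGroup n,
      BandBraid.IsCanonicalFactor A → P ∈ BandBraid.positiveBraids n →
      BandBraid.startingSet A ⊆ BandBraid.startingSet P →
      ∃ P' : BandBraid.BraidGroup n, BandBraid.BraidLE 1 P' ∧ P = A * P') ∧
    -- (VII)
    (∀ P : BandBraid.BraidGroup n, BandBraid.BraidLE 1 P →
      ∃! A : BandBraid.BraidGroup n, BandBraid.IsCanonicalFactor A ∧
        (∃ P' : BandBraid.BraidGroup n, BandBraid.BraidLE 1 P' ∧ P = A * P') ∧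
        BandBraid.startingSet P = BandBraid.startingSet A) := by

  open BandBraid BandBraid.LengthFunction in
  have hdiv : ∀ (w : NCPerm n) (p : DualMonoid n),
      startingSet (bandLift w) ⊆ startingSet (toBraid p) →
      ∃ P' : BraidGroup n, BraidLE 1 P' ∧ toBraid p = bandLift w * P' := by
    intro w p h
    rw [startingSet_bandLift, startingSet_toBraid, bandsBelow_subset_iff] at h
    obtain ⟨q, hq⟩ := exists_eq_gen_mul_iff.2 h
    exact ⟨toBraid q, braidLE_one_iff.2 (toBraid_mem q), by
      rw [← toBraid_gen, ← map_mul, ← hq]⟩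
  open BandBraid BandBraid.LengthFunction in
  refine ⟨fun π => ?_, startingSet_prod_of_parallel, ?_, ?_, ?_, ?_, ?_⟩
  · rw [π.braid_eq, startingSet_bandLift, finishingSet_bandLift, π.bandsBelow_perm]
    exact ⟨rfl, rfl⟩
  · intro A hA
    obtain ⟨w, rfl⟩ := isCanonicalFactor_iff.1 hA
    rw [startingSet_bandLift, finishingSet_bandLift]
  · intro A B hA hB h
    obtain ⟨u, rfl⟩ := isCanonicalFactor_iff.1 hA
    obtain ⟨v, rfl⟩ := isCanonicalFactor_iff.1 hB
    rw [startingSet_bandLift, startingSet_bandLift] at h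
    rw [bandsBelow_injective h]
  · intro P hP
    obtain ⟨p, rfl⟩ := exists_toBraid_eq hP
    exact ⟨_, isCanonicalFactor_iff.2 ⟨p.head, rfl⟩, by
      rw [startingSet_toBraid, startingSet_bandLift]⟩
  · intro A P hA hP h
    obtain ⟨w, rfl⟩ := isCanonicalFactor_iff.1 hA
    obtain ⟨p, rfl⟩ := exists_toBraid_eq hP
    exact hdiv w p h
  · intro P hP
    obtain ⟨p, rfl⟩ := exists_toBraid_eq (braidLE_one_iff.1 hP)
    have hS : startingSet (toBraid p) = startingSet (bandLift p.head) := by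
      rw [startingSet_toBraid, startingSet_bandLift]
    -- The head is the required factor; uniqueness needs only the equality of starting sets.
    refine ⟨bandLift p.head, ⟨isCanonicalFactor_iff.2 ⟨_, rfl⟩, hdiv _ _ hS.ge, hS⟩, ?_⟩
    rintro B ⟨hB, -, hB'⟩
    obtain ⟨w, rfl⟩ := isCanonicalFactor_iff.1 hB
    rw [startingSet_toBraid, startingSet_bandLift] at hB'
    rw [bandsBelow_injective hB']
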